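/- Let $r\ge 0$, let $G_1,\dots,G_r$ be finite (discrete) groups of orders $m_i=|G_i|$, and let $K$ be the simplicial complex consisting of $r$ isolated vertices $1,\dots,r$ (its simplices are $\varnothing,\{1\},\dots,\{r\}$). For pairs of spaces $(X_i,A_i)$, $1\le i\le r$, the polyhedral product is $$Z_K(\underline X,\underline A)=\bigcup_{\sigma\in K}\{x\in X_1\times\cdots\times X_r : x_i\in A_i\text{ for all } i\notin\sigma\}$$ with the subspace topology. Define $N_0=0$ and $$N_s=m_sN_{s-1}+(m_s-1)\Bigl(\prod_{i<s}m_i-1\Bigr)\qquad(1\le s\le r),$$ so that $N_1=0$ and $N_2=(m_1-1)(m_2-1)$. For each $i$ let $EG_i$ be any contractible CW complex with a free continuous action of $G_i$ having a point $x_i$ whose orbit is a subcomplex, and identify $G_i$ with the orbit $G_ix_i\subseteq EG_i$. Let $F_i$ be any subset of $I=[0,1]$ with exactly $m_i$ elements. Then: 1. $Z_K(\underline I,\underline F)\simeq\bigvee_{N_r}S^1$; 2. $Z_K(\underline{EG},\underline G)\simeq Z_K(\underline I,\underline F)$, and hence $Z_K(\underline{EG},\underline G)\simeq\bigvee_{N_r}S^1$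 (a wedge of $0$ circles being a point); 3. $N_r=(r-1)\prod_{i=1}^r m_i-\sum_{i=1}^r\prod_{j\ne i}m_j+1$; 4. the canonical homomorphism $G_1*\cdots*G_r\to G_1\times\cdots\times G_r$ is surjective and its kernel is a free group of rank $N_r$. -/

import Mathlib

open Topology

/-- The polyhedral product `Z_K(X, A)`, as a subset of the product `∏ i, X i`: the union, over the
simplices `σ` of `K` (the empty one included, which Mathlib does not count among the faces),
of the products whose `i`-th factor is `X i` for `i ∈ σ` and `A i` for `i ∉ σ`.
As a space it carries the subspace topology of the product topology. -/
def polyhedralProduct {ι : Type*} (K : AbstractSimplicialComplex ι) {X : ι → Type*}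
    (A : ∀ i, Set (X i)) : Set (∀ i, X i) :=
  ⋃ σ ∈ insert ∅ K.faces, {x | ∀ i, i ∉ σ → x i ∈ A i}

/-- The simplicial complex whose only nonempty simplices are its `r` vertices. -/
def discreteComplex (r : ℕ) : AbstractSimplicialComplex (Fin r) where
  faces := {σ | ∃ v, σ = {v}}
  isRelLowerSet_faces := by
    rintro σ ⟨v, rfl⟩
    refine ⟨Finset.singleton_nonempty v, fun τ hτ hne => ?_⟩
    exact ⟨v, (Finset.subset_singleton_iff.mp hτ).resolve_left hne.ne_empty⟩
  singleton_mem := fun v => ⟨v, rfl⟩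

/-- `(X, A)` is a CW pair: `X` is a Hausdorff space that has a CW structure of which `A` is
a subcomplex. -/
def IsCWPair {X : Type*} [TopologicalSpace X] (A : Set X) : Prop :=
  T2Space X ∧ ∃ (_ : CWComplex (Set.univ : Set X))
    (S : RelCWComplex.Subcomplex (Set.univ : Set X)), (S : Set X) = A

/-- `(E, G)` is a model of the pair `(EG, G)` for a discrete group `G`: a contractible space `E`
with a free continuous action of `G`, in which `G` is identified with the orbit of the point `x`,
and the orbit is a subcomplex of `E`. -/
structure IsUniversalPair (G : Type*) [Group G] (E : Type*) [TopologicalSpace E] [MulAction G E]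
    (x : E) : Prop where
  contractible : ContractibleSpace E
  continuous_smul : ∀ g : G, Continuous fun e : E => g • e
  free : ∀ (g : G) (e : E), g • e = e → g = 1
  isCWPair : IsCWPair (MulAction.orbit G x)

/-- Glues the point `1` of each circle in a disjoint union of `N` circles to one extra point. -/
inductive WedgeRel (N : ℕ) : Unit ⊕ (Fin N × Circle) → Unit ⊕ (Fin N × Circle) → Prop
  | glue (k : Fin N) : WedgeRel N (Sum.inr (k, 1)) (Sum.inl ())

/-- The wedge of `N` circles, with the quotient topology (a point if `N = 0`). -/
def WedgeOfCircles (N : ℕ) : Type := Quot (WedgeRel N)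

instance (N : ℕ) : TopologicalSpace (WedgeOfCircles N) :=
  inferInstanceAs (TopologicalSpace (Quot (WedgeRel N)))

/-- The number `N_r`, by `N_0 = 0` and
`N_r = m_r N_{r-1} + (m_r - 1) (m_1 ⋯ m_{r-1} - 1)`, for positive integers `m_i`;
so `N_1 = 0` and `N_2 = (m_1 - 1) (m_2 - 1)`. -/
def circleCount : (r : ℕ) → (Fin r → ℕ) → ℕ
  | 0, _ => 0
  | r + 1, m =>
    m (Fin.last r) * circleCount r (fun i => m i.castSucc) +
      (m (Fin.last r) - 1) * ((∏ i : Fin r, m i.castSucc) - 1)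

/-- The canonical homomorphism from the free product of the groups `G i` to their product. -/
def freeProductToProduct {r : ℕ} (G : Fin r → Type*) [∀ i, Group (G i)] :
    Monoid.CoprodI G →* (∀ i, G i) :=
  Monoid.CoprodI.lift fun i => MonoidHom.mulSingle G i

open unitInterval

set_option linter.unusedSectionVars false

/-! The pairs `(I, F_i)` and `(EG_i, G_i)` are both equivalent to the interval `[0, m_i - 1]` with
its integer points, by homotopies fixed on the subspaces (`pairEquiv_unitInterval`,
`IsUniversalPair.pairEquiv`). Such equivalences act coordinatewise on polyhedral products
(`polyhedralProduct_homotopyEquiv`), so the topology reduces to the union of the grid lines in a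
box. This is a finite graph: for every vertex `q` and every `i` with `q i ≠ 0`, an edge `(i, q)`
leads to `q` from `q` with coordinate `i` lowered by one. The edges for which `i` is the first
nonzero coordinate of `q` form a spanning tree: each `q ≠ 0` has exactly one, and repeated lowering
ends at `0`. Collapsing the tree leaves a rose on the remaining edges, the type `ExtraEdge`
(`treeGraph_homotopyEquiv_rose`). Splitting off the last coordinate counts them by the recursion for
`N_r` (`card_extraEdge`).

The kernel is computed algebraically with the same index set, where `(i, q)` now joins `q` to `q`
with coordinate `i` reset to `1`. Extra edges are labelled by free generators and tree edges by `1`.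
An element of the free product prescribes a walk from each point of the product; its label is a
cocycle, encoded by `cocycleHom` in a wreath product. At the point `1` it restricts to a
homomorphism from the kernel to the free group. The inverse sends a generator to the loop that goes
through the tree and traverses its edge once (`loopHom_cocycleHom`, `cocycleHom_loop`). -/

/-! ### Counting the edges outside the spanning tree -/

/-- The pairs `(i, q)` for which `q i` is not the base point, and neither is some `q j` with
`j < i`. -/
abbrev ExtraEdge {r : ℕ} {T : Fin r → Type*} (b : ∀ i, T i) : Type _ :=
  {p : Fin r × (∀ i, T i) // p.2 p.1 ≠ b p.1 ∧ ∃ j < p.1, p.2 j ≠ b j}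

/-- An extra edge over `Fin (r + 1)` is one over `Fin r` with an arbitrary last coordinate, or
has the last index and is determined by a nontrivial last coordinate and a nontrivial rest. -/
noncomputable def extraEdgeSuccEquiv {r : ℕ} {T : Fin (r + 1) → Type*} (b : ∀ i, T i) :
    ExtraEdge b ≃ (T (Fin.last r) × ExtraEdge fun i : Fin r => b i.castSucc) ⊕
      ({x : T (Fin.last r) // x ≠ b (Fin.last r)} ×
        {q : ∀ i : Fin r, T i.castSucc // q ≠ fun i : Fin r => b i.castSucc}) :=
  Equiv.symm <| Equiv.ofBijective
    (Sum.elim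
      (fun p => ⟨(p.2.1.1.castSucc, Fin.snoc p.2.1.2 p.1), by
        obtain ⟨x, ⟨⟨i, q⟩, h, j, hj, hq⟩⟩ := p
        exact ⟨by simpa using h, j.castSucc, by simpa using hj, by simpa using hq⟩⟩)
      (fun p => ⟨(Fin.last r, Fin.snoc p.2.1 p.1.1), by
        obtain ⟨⟨x, hx⟩, ⟨q, hq⟩⟩ := p
        obtain ⟨j, hj⟩ := Function.ne_iff.mp hq
        exact ⟨by simpa using hx, j.castSucc, Fin.castSucc_lt_last j, by simpa using hj⟩⟩)) <| by
    constructor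
    · rintro (⟨x, ⟨⟨i, q⟩, h⟩⟩ | ⟨⟨x, hx⟩, ⟨q, hq⟩⟩)
        (⟨x', ⟨⟨i', q'⟩, h'⟩⟩ | ⟨⟨x', hx'⟩, ⟨q', hq'⟩⟩) e
      · have e' := Subtype.ext_iff.mp e
        simp only [Sum.elim_inl, Prod.mk.injEq, Fin.castSucc_inj] at e'
        obtain ⟨rfl, e2⟩ := e'
        obtain ⟨rfl, rfl⟩ := Fin.snoc_injective2 e2
        rfl
      · have e' := Subtype.ext_iff.mp e
        simp only [Sum.elim_inl, Sum.elim_inr, Prod.mk.injEq] at e'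
        exact absurd e'.1 (Fin.castSucc_lt_last i).ne
      · have e' := Subtype.ext_iff.mp e
        simp only [Sum.elim_inl, Sum.elim_inr, Prod.mk.injEq] at e'
        exact absurd e'.1.symm (Fin.castSucc_lt_last i').ne
      · have e' := Subtype.ext_iff.mp e
        simp only [Sum.elim_inr, Prod.mk.injEq] at e'
        obtain ⟨rfl, rfl⟩ := Fin.snoc_injective2 e'.2
        rfl
    · rintro ⟨⟨i, q⟩, h, j, hj, hq⟩
      induction i using Fin.lastCases with
      | last =>
        refine ⟨Sum.inr (⟨q (Fin.last r), h⟩, ⟨fun i => q i.castSucc, fun e => hq ?_⟩), ?_⟩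
        · obtain ⟨j, rfl⟩ := Fin.exists_castSucc_eq.mpr hj.ne
          exact congrFun e j
        · exact Subtype.ext (Prod.ext rfl (Fin.snoc_init_self q))
      | cast i =>
        obtain ⟨j, rfl⟩ := Fin.exists_castSucc_eq.mpr (hj.trans (Fin.castSucc_lt_last i)).ne
        refine ⟨Sum.inl (q (Fin.last r), ⟨(i, fun i => q i.castSucc), h, j,
          by simpa using hj, hq⟩), ?_⟩
        exact Subtype.ext (Prod.ext rfl (Fin.snoc_init_self q))

theorem Nat.card_subtype_ne {α : Type*} [Finite α] (a : α) :
    Nat.card {x : α // x ≠ a} = Nat.card α - 1 := by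
  classical
  have := Fintype.ofFinite α
  rw [Nat.card_eq_fintype_card, Nat.card_eq_fintype_card, Fintype.card_subtype_compl,
    Fintype.card_subtype_eq]

/-- The two summands of `extraEdgeSuccEquiv` have the sizes of the two terms in the recursion of
`circleCount`. -/
theorem card_extraEdge {r : ℕ} {T : Fin r → Type*} [∀ i, Finite (T i)] (b : ∀ i, T i) :
    Nat.card (ExtraEdge b) = circleCount r fun i => Nat.card (T i) := by
  induction r with
  | zero =>
    have : IsEmpty (ExtraEdge b) := ⟨fun p => p.1.1.elim0⟩
    rw [Nat.card_of_isEmpty, circleCount]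
  | succ r ih =>
    rw [Nat.card_congr (extraEdgeSuccEquiv b), Nat.card_sum, Nat.card_prod, Nat.card_prod, ih,
      Nat.card_subtype_ne, Nat.card_subtype_ne, Nat.card_pi, circleCount]

theorem circleCount_closed_form (r : ℕ) (m : Fin r → ℕ) (hm : ∀ i, 0 < m i) :
    (circleCount r m : ℤ) =
      ((r : ℤ) - 1) * ∏ i, (m i : ℤ) - ∑ i, ∏ j ∈ Finset.univ.erase i, (m j : ℤ) + 1 := by
  -- Products over all indices, with one factor replaced by `1`, split off their last factor
  -- directly in the induction.
  have key : ∀ (r : ℕ) (m : Fin r → ℕ) (i : Fin r),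
      ∏ j ∈ Finset.univ.erase i, (m j : ℤ) = ∏ j, if j = i then 1 else (m j : ℤ) := by
    intro r m i
    rw [← Finset.mul_prod_erase Finset.univ _ (Finset.mem_univ i), if_pos rfl, one_mul]
    exact Finset.prod_congr rfl fun j hj => by rw [if_neg (Finset.ne_of_mem_erase hj)]
  simp only [key]
  induction r with
  | zero => simp [circleCount]
  | succ r ih =>
    -- Positivity makes the truncated subtractions of the recursion agree with those in `ℤ`.
    have h1 : 1 ≤ m (Fin.last r) := hm _
    have h2 : 1 ≤ ∏ i : Fin r, m i.castSucc := Finset.prod_pos fun i _ => hm _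
    rw [circleCount]
    push_cast [Nat.cast_sub h1, Nat.cast_sub h2]
    rw [ih (fun i => m i.castSucc) fun i => hm _]
    simp only [Fin.prod_univ_castSucc, Fin.sum_univ_castSucc, Fin.castSucc_inj,
      (Fin.castSucc_lt_last _).ne, (Fin.castSucc_lt_last _).ne', if_true, if_false,
      ← Finset.sum_mul]
    ring

theorem exists_firstIndex {r : ℕ} {T : Fin r → Type*} {b q : ∀ i, T i} (h : q ≠ b) :
    ∃ i, q i ≠ b i ∧ ∀ j < i, q j = b j := by
  obtain ⟨i, hi, hmin⟩ := WellFounded.has_min (wellFounded_lt (α := Fin r)) {i | q i ≠ b i}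
    (Function.ne_iff.mp h)
  exact ⟨i, hi, fun j hj => by_contra fun hne => hmin j hne hj⟩

/-- The first index at which `q` differs from `b`. -/
noncomputable def firstIndex {r : ℕ} {T : Fin r → Type*} {b q : ∀ i, T i} (h : q ≠ b) : Fin r :=
  (exists_firstIndex h).choose

theorem firstIndex_ne {r : ℕ} {T : Fin r → Type*} {b q : ∀ i, T i} (h : q ≠ b) :
    q (firstIndex h) ≠ b (firstIndex h) :=
  (exists_firstIndex h).choose_spec.1

theorem eq_of_lt_firstIndex {r : ℕ} {T : Fin r → Type*} {b q : ∀ i, T i} (h : q ≠ b) {j : Fin r}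
    (hj : j < firstIndex h) : q j = b j :=
  (exists_firstIndex h).choose_spec.2 j hj

theorem firstIndex_eq {r : ℕ} {T : Fin r → Type*} {b q : ∀ i, T i} (h : q ≠ b) {i : Fin r}
    (hi : q i ≠ b i) (hlt : ∀ j < i, q j = b j) : firstIndex h = i :=
  le_antisymm (not_lt.mp fun hj => hi (eq_of_lt_firstIndex h hj))
    (not_lt.mp fun hj => firstIndex_ne h (hlt _ hj))

/-! ### The kernel of the free product onto the product -/

namespace FreeProductKernel

open Monoid

variable {r : ℕ} {G : Fin r → Type*} [∀ i, Group (G i)]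

/-- The action of a group `Q` on the functions on `Q` by right translation. -/
def translation (Q F : Type*) [Group Q] [Group F] : Q →* MulAut (Q → F) where
  toFun g :=
    { toFun := fun f q => f (q * g)
      invFun := fun f q => f (q * g⁻¹)
      left_inv := fun f => by simp
      right_inv := fun f => by simp
      map_mul' := fun _ _ => rfl }
  map_one' := by ext; simp
  map_mul' g h := by ext; simp [mul_assoc]

/-- The free group on the extra edges. -/
abbrev EdgeGroup (G : Fin r → Type*) [∀ i, Group (G i)] : Type _ :=
  FreeGroup (ExtraEdge fun i => (1 : G i))

/-- The target of the cocycle homomorphism: functions on the product, extended by the product. -/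
abbrev Wreath (G : Fin r → Type*) [∀ i, Group (G i)] : Type _ :=
  (((i : Fin r) → G i) → EdgeGroup G) ⋊[translation ((i : Fin r) → G i) (EdgeGroup G)]
    ((i : Fin r) → G i)

open Classical in
/-- The generator of the pair `(i, q)`, which is trivial unless the pair is an extra edge. -/
noncomputable def edgeGen (i : Fin r) (q : ∀ i, G i) : EdgeGroup G :=
  if h : q i ≠ 1 ∧ ∃ j < i, q j ≠ 1 then FreeGroup.of ⟨(i, q), h⟩ else 1

theorem edgeGen_coe (e : ExtraEdge fun i => (1 : G i)) :
    edgeGen e.1.1 e.1.2 = FreeGroup.of e :=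
  dif_pos e.2

theorem edgeGen_of_eq_one {i : Fin r} {q : ∀ i, G i} (h : q i = 1) : edgeGen i q = 1 :=
  dif_neg fun h' => h'.1 h

theorem edgeGen_of_forall_lt {i : Fin r} {q : ∀ i, G i} (h : ∀ j < i, q j = 1) :
    edgeGen i q = 1 :=
  dif_neg fun ⟨_, j, hj, hq⟩ => hq (h j hj)

/-- On the factor `G i` this is the inclusion conjugated by the generators of the pairs
`(i, q)`. -/
noncomputable def cocycleHom (G : Fin r → Type*) [∀ i, Group (G i)] : CoprodI G →* Wreath G :=
  CoprodI.lift fun i =>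
    (MulAut.conj (SemidirectProduct.inl (edgeGen i) : Wreath G)⁻¹).toMonoidHom.comp
      (SemidirectProduct.inr.comp (MonoidHom.mulSingle G i))

/-- The coset of `G i` through `q` is a star centred at the point with `i`-th coordinate `1`.
Multiplying by `g` walks from `q` to the centre and out again, which gives the two labels. -/
theorem cocycleHom_of_left {i : Fin r} (g : G i) (q : ∀ i, G i) :
    (cocycleHom G (CoprodI.of g)).left q =
      (edgeGen i q)⁻¹ * edgeGen i (q * Pi.mulSingle i g) := by
  rw [cocycleHom, CoprodI.lift_of]
  change ((SemidirectProduct.inl (edgeGen i) : Wreath G)⁻¹ *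
    SemidirectProduct.inr (Pi.mulSingle i g) *
      ((SemidirectProduct.inl (edgeGen i) : Wreath G)⁻¹)⁻¹).left q = _
  simp only [inv_inv, SemidirectProduct.mul_left, SemidirectProduct.inv_left,
    SemidirectProduct.left_inl, SemidirectProduct.right_inl, SemidirectProduct.left_inr,
    SemidirectProduct.right_inr, SemidirectProduct.mul_right, SemidirectProduct.inv_right,
    map_one, inv_one, one_mul, mul_one, MulAut.one_apply, Pi.mul_apply, Pi.inv_apply]
  rfl

theorem cocycleHom_right (p : CoprodI G) : (cocycleHom G p).right = freeProductToProduct G p := by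
  suffices h : (SemidirectProduct.rightHom).comp (cocycleHom G) = freeProductToProduct G from
    DFunLike.congr_fun h p
  refine CoprodI.ext_hom _ _ fun i => MonoidHom.ext fun g => ?_
  simp [cocycleHom, freeProductToProduct]

/-- This is the cocycle identity: the second walk starts where the first one ends. On the kernel the
starting point does not move, so evaluation at `1` is multiplicative there. -/
theorem cocycleHom_mul_left (p p' : CoprodI G) (q : ∀ i, G i) :
    (cocycleHom G (p * p')).left q =
      (cocycleHom G p).left q * (cocycleHom G p').left (q * freeProductToProduct G p) := by
  rw [map_mul, SemidirectProduct.mul_left, Pi.mul_apply, cocycleHom_right]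
  rfl

theorem cocycleHom_one_left (q : ∀ i, G i) : (cocycleHom G 1).left q = 1 := by
  rw [map_one]; rfl

open Classical in
/-- The word that multiplies the coordinates of `q` in descending order of their indices. -/
noncomputable def word (q : ∀ i, G i) : CoprodI G :=
  if h : q ≠ 1 then
    word (Function.update q (firstIndex h) 1) * CoprodI.of (q (firstIndex h))
  else 1
termination_by (Finset.univ.filter fun i => q i ≠ 1).card
decreasing_by
  refine Finset.card_lt_card (Finset.ssubset_iff_of_subset ?_ |>.mpr ⟨firstIndex h, ?_, ?_⟩)
  · intro i hi
    by_cases hi' : i = firstIndex h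
    · subst hi'; simp at hi
    · simpa [hi'] using hi
  · simpa using firstIndex_ne h
  · simp

theorem word_one : word (1 : ∀ i, G i) = 1 := by
  rw [word, dif_neg (not_not.mpr rfl)]

theorem word_of_ne {q : ∀ i, G i} (h : q ≠ 1) :
    word q = word (Function.update q (firstIndex h) 1) * CoprodI.of (q (firstIndex h)) := by
  rw [word, dif_pos h]

theorem update_one_mul_mulSingle (q : ∀ i, G i) (i : Fin r) :
    Function.update q i 1 * Pi.mulSingle i (q i) = q := by
  ext j
  by_cases h : j = i
  · subst h; simp
  · simp [h]

theorem freeProductToProduct_word (q : ∀ i, G i) : freeProductToProduct G (word q) = q := by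
  induction q using word.induct with
  | case1 q h ih =>
    rw [word_of_ne h, map_mul, ih]
    simpa [freeProductToProduct] using update_one_mul_mulSingle q (firstIndex h)
  | case2 q h => rw [not_not.mp h, word_one, map_one]

/-- `word q` goes from `1` to `q` inside the spanning tree, where all labels are trivial. -/
theorem cocycleHom_word (q : ∀ i, G i) : (cocycleHom G (word q)).left 1 = 1 := by
  induction q using word.induct with
  | case1 q h ih =>
    rw [word_of_ne h, cocycleHom_mul_left, ih, one_mul, one_mul, freeProductToProduct_word,
      cocycleHom_of_left, update_one_mul_mulSingle, edgeGen_of_eq_one (by simp),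
      edgeGen_of_forall_lt fun j hj => eq_of_lt_firstIndex h hj, inv_one, one_mul]
  | case2 q h => rw [not_not.mp h, word_one, cocycleHom_one_left]

/-- The loop that follows the word of `q` without its `i`-th coordinate, then the pair `(i, q)`,
and then returns along the word of `q`. -/
noncomputable def loop (i : Fin r) (q : ∀ i, G i) : CoprodI G :=
  word (Function.update q i 1) * CoprodI.of (q i) * (word q)⁻¹

/-- Such a pair is degenerate or a tree edge. In the second case `word q` itself ends with this
edge, so the loop retraces its path. -/
theorem loop_eq_one {i : Fin r} {q : ∀ i, G i} (h : ¬ (q i ≠ 1 ∧ ∃ j < i, q j ≠ 1)) :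
    loop i q = 1 := by
  by_cases hi : q i = 1
  · rw [loop, hi, map_one, mul_one, ← hi, Function.update_eq_self, mul_inv_cancel]
  · have hlt : ∀ j < i, q j = 1 := fun j hj => by_contra fun hne => h ⟨hi, j, hj, hne⟩
    have hq : q ≠ 1 := fun e => hi (congrFun e i)
    have hf : firstIndex hq = i := firstIndex_eq hq hi hlt
    rw [loop, mul_inv_eq_one, word_of_ne hq, hf]

theorem freeProductToProduct_loop (i : Fin r) (q : ∀ i, G i) :
    freeProductToProduct G (loop i q) = 1 := by
  rw [loop, map_mul, map_mul, map_inv, freeProductToProduct_word, freeProductToProduct_word,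
    mul_inv_eq_one]
  simpa [freeProductToProduct] using update_one_mul_mulSingle q i

/-- The homomorphism that sends the extra edges to their loops. -/
noncomputable def loopHom (G : Fin r → Type*) [∀ i, Group (G i)] : EdgeGroup G →* CoprodI G :=
  FreeGroup.lift fun e => loop e.1.1 e.1.2

theorem loopHom_edgeGen (i : Fin r) (q : ∀ i, G i) : loopHom G (edgeGen i q) = loop i q := by
  by_cases h : q i ≠ 1 ∧ ∃ j < i, q j ≠ 1
  · rw [edgeGen, dif_pos h, loopHom, FreeGroup.lift_apply_of]
  · rw [edgeGen, dif_neg h, map_one, loop_eq_one h]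

/-- Both sides obey the same cocycle identity, so it suffices to take `p` in one factor, where the
words to the common centre of the star cancel. For `q = 1` and `p` in the kernel the right side is
`p`, which gives one of the two inverse laws. -/
theorem loopHom_cocycleHom (p : CoprodI G) (q : ∀ i, G i) :
    loopHom G ((cocycleHom G p).left q) =
      word q * p * (word (q * freeProductToProduct G p))⁻¹ := by
  induction p using CoprodI.induction_on generalizing q with
  | one => simp
  | of i g =>
    have h : Function.update (q * Pi.mulSingle i g) i 1 = Function.update q i 1 := by
      ext j
      by_cases hj : j = i
      · subst hj; simp
      · simp [hj]
    have h' : freeProductToProduct G (CoprodI.of g) = Pi.mulSingle i g := by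
      simp [freeProductToProduct]
    rw [cocycleHom_of_left, map_mul, map_inv, loopHom_edgeGen, loopHom_edgeGen, loop, loop, h, h']
    simp only [Pi.mul_apply, Pi.mulSingle_eq_same, map_mul]
    group
  | mul p p' ih ih' =>
    rw [cocycleHom_mul_left, map_mul, ih, ih', map_mul, mul_assoc q]
    group

theorem cocycleHom_loop (i : Fin r) (q : ∀ i, G i) :
    (cocycleHom G (loop i q)).left 1 = edgeGen i q := by
  -- Appending `word q` cancels the way back, and leaves the value unchanged because the label of
  -- `word q` is trivial.
  have h := cocycleHom_mul_left (loop i q) (word q) 1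
  rw [freeProductToProduct_loop, one_mul, cocycleHom_word, mul_one, loop, inv_mul_cancel_right,
    cocycleHom_mul_left, cocycleHom_word, freeProductToProduct_word, one_mul, one_mul,
    cocycleHom_of_left, update_one_mul_mulSingle, edgeGen_of_eq_one (by simp), inv_one,
    one_mul] at h
  exact h.symm

/-- The kernel of the canonical homomorphism is free on the extra edges. -/
noncomputable def kerEquiv (G : Fin r → Type*) [∀ i, Group (G i)] :
    (freeProductToProduct G).ker ≃* EdgeGroup G :=
  MonoidHom.toMulEquiv
    { toFun := fun k => (cocycleHom G k.1).left 1
      map_one' := cocycleHom_one_left 1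
      map_mul' := fun k k' => by
        rw [Subgroup.coe_mul, cocycleHom_mul_left, MonoidHom.mem_ker.mp k.2, one_mul] }
    ((loopHom G).codRestrict _ fun x => by
      rw [MonoidHom.mem_ker, ← MonoidHom.comp_apply]
      suffices h : (freeProductToProduct G).comp (loopHom G) = 1 by rw [h, MonoidHom.one_apply]
      ext1 e
      rw [MonoidHom.comp_apply, ← edgeGen_coe, loopHom_edgeGen, freeProductToProduct_loop,
        MonoidHom.one_apply])
    (MonoidHom.ext fun k => Subtype.ext <| by
      have h := loopHom_cocycleHom k.1 1
      rw [MonoidHom.mem_ker.mp k.2, mul_one, word_one, inv_one, mul_one, one_mul] at h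
      exact h)
    (by
      ext1 e
      change (cocycleHom G (loopHom G (FreeGroup.of e))).left 1 = FreeGroup.of e
      rw [← edgeGen_coe, loopHom_edgeGen, cocycleHom_loop])

end FreeProductKernel

theorem freeProductToProduct_surjective {r : ℕ} (G : Fin r → Type*) [∀ i, Group (G i)] :
    Function.Surjective (freeProductToProduct G) :=
  fun q => ⟨_, FreeProductKernel.freeProductToProduct_word q⟩

theorem freeProductToProduct_ker_free {r : ℕ} (G : Fin r → Type*) [∀ i, Group (G i)]
    [∀ i, Finite (G i)] :
    Nonempty ((freeProductToProduct G).ker ≃*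
      FreeGroup (Fin (circleCount r fun i => Nat.card (G i)))) := by
  rw [← card_extraEdge fun i => (1 : G i)]
  exact ⟨(FreeProductKernel.kerEquiv G).trans (FreeGroup.freeGroupCongr (Finite.equivFin _))⟩

/-! ### Graphs and homotopies of maps out of them -/

/-- Glues the ends of the edges `e` of a graph to the vertices `s e` and `t e`. -/
inductive GraphRel {V E : Type*} (s t : E → V) : V ⊕ E × unitInterval → V ⊕ E × unitInterval → Prop
  | source (e : E) : GraphRel s t (Sum.inr (e, 0)) (Sum.inl (s e))
  | target (e : E) : GraphRel s t (Sum.inr (e, 1)) (Sum.inl (t e))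

/-- The geometric realization of the graph with vertices `V` and edges `E`, of which `e` goes from
`s e` to `t e`. -/
def GraphSpace {V E : Type*} (s t : E → V) : Type _ := Quot (GraphRel s t)

namespace GraphSpace

variable {V E : Type*} [TopologicalSpace V] [DiscreteTopology V] [TopologicalSpace E]
  [DiscreteTopology E] {s t : E → V} {Y : Type*} [TopologicalSpace Y]

instance : TopologicalSpace (GraphSpace s t) :=
  inferInstanceAs (TopologicalSpace (Quot (GraphRel s t)))

/-- A vertex, as a point of the realization. -/
def vert (v : V) : GraphSpace s t := Quot.mk _ (Sum.inl v)

/-- An edge, as a path in the realization. -/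
def edge (e : E) : Path (vert (s e) : GraphSpace s t) (vert (t e)) where
  toFun x := Quot.mk _ (Sum.inr (e, x))
  continuous_toFun := continuous_quot_mk.comp (by fun_prop)
  source' := Quot.sound (GraphRel.source e)
  target' := Quot.sound (GraphRel.target e)

/-- The map out of the realization that is given by points and paths between them. -/
def lift (φ : V → Y) (ψ : ∀ e, Path (φ (s e)) (φ (t e))) : C(GraphSpace s t, Y) where
  toFun := Quot.lift (Sum.elim φ fun p => ψ p.1 p.2) (by
    rintro _ _ (e | e)
    · exact (ψ e).source
    · exact (ψ e).target)
  continuous_toFun := by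
    refine continuous_quot_lift _ (continuous_sum_dom.mpr ⟨continuous_of_discreteTopology, ?_⟩)
    exact continuous_prod_of_discrete_left.mpr fun e => (ψ e).continuous

@[simp]
theorem lift_edge (φ : V → Y) (ψ : ∀ e, Path (φ (s e)) (φ (t e))) (e : E) (x : unitInterval) :
    lift φ ψ (edge e x) = ψ e x := rfl

theorem ind {p : GraphSpace s t → Prop} (hv : ∀ v, p (vert v)) (he : ∀ e x, p (edge e x))
    (a : GraphSpace s t) : p a := by
  obtain ⟨v | ⟨e, x⟩⟩ := a
  · exact hv v
  · exact he e x

/-- A homotopy of maps out of the realization consists of a path for each vertex, and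
a square for each edge. -/
theorem homotopic_of_squares {f g : C(GraphSpace s t, Y)} (τ : ∀ v, Path (f (vert v)) (g (vert v)))
    (h : ∀ e, ∃ H : C(unitInterval × unitInterval, Y), (∀ y, H (0, y) = τ (s e) y) ∧
      (∀ y, H (1, y) = τ (t e) y) ∧ (∀ x, H (x, 0) = f (edge e x)) ∧
      ∀ x, H (x, 1) = g (edge e x)) : f.Homotopic g := by
  choose H hs ht hf hg using h
  -- Currying turns the homotopy into a map from the graph to a path space, so no quotient topology
  -- on a product with `I` is needed.
  let K : C(GraphSpace s t, C(unitInterval, Y)) := lift (fun v => (τ v : C(unitInterval, Y)))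
    fun e =>
      { toContinuousMap := (H e).curry
        source' := ContinuousMap.ext fun y => hs e y
        target' := ContinuousMap.ext fun y => ht e y }
  refine ⟨⟨K.uncurry.comp ⟨Prod.swap, continuous_swap⟩, ?_, ?_⟩⟩
  · refine ind (fun v => (τ v).source) fun e x => hf e x
  · refine ind (fun v => (τ v).target) fun e x => hg e x

/-- Maps that agree on the vertices and are path homotopic on the edges are homotopic. -/
theorem homotopic_of_edges {φ : V → Y} {ψ ψ' : ∀ e, Path (φ (s e)) (φ (t e))}
    (h : ∀ e, (ψ e).Homotopic (ψ' e)) : (lift φ ψ).Homotopic (lift φ ψ') := by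
  refine homotopic_of_squares (fun v => Path.refl (φ v)) fun e => ?_
  obtain ⟨F⟩ := h e
  refine ⟨(F : C(unitInterval × unitInterval, Y)).comp ⟨Prod.swap, continuous_swap⟩, ?_, ?_, ?_, ?_⟩
  · exact fun y => F.source y
  · exact fun y => F.target y
  · exact fun x => F.apply_zero x
  · exact fun x => F.apply_one x

end GraphSpace

/-- The map on the line that runs through `l` backwards on `[-1, 0]`, through `a` on `[0, 1]` and
through `r` on `[1, 2]`. -/
noncomputable def lineMap {Y : Type*} [TopologicalSpace Y] {a₀ a₁ b₀ b₁ : Y} (l : Path a₀ b₀)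
    (a : Path a₀ a₁) (r : Path a₁ b₁) : C(ℝ, Y) where
  toFun z := if z ≤ 0 then l.extend (-z) else if z ≤ 1 then a.extend z else r.extend (z - 1)
  continuous_toFun := by
    refine Continuous.if_le (by fun_prop) (Continuous.if_le (by fun_prop) (by fun_prop)
      continuous_id continuous_const ?_) continuous_id continuous_const ?_
    · rintro z rfl; simp
    · rintro z rfl; simp

section lineMap

variable {Y : Type*} [TopologicalSpace Y] {a₀ a₁ b₀ b₁ : Y} (l : Path a₀ b₀)
    (a : Path a₀ a₁) (r : Path a₁ b₁)

theorem lineMap_neg (y : I) : lineMap l a r (-y) = l y := by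
  have : -(y : ℝ) ≤ 0 := by simpa using y.2.1
  simp only [lineMap, ContinuousMap.coe_mk, if_pos this, neg_neg, Path.extend_apply l y.2]

theorem lineMap_mid (y : I) : lineMap l a r y = a y := by
  by_cases h : (y : ℝ) ≤ 0
  · have : y = 0 := Subtype.ext (le_antisymm h y.2.1)
    subst this
    simp [lineMap]
  · simp [lineMap, h, y.2.2]

theorem lineMap_one_add (y : I) : lineMap l a r (1 + y) = r y := by
  have h0 : ¬ (1 + (y : ℝ) ≤ 0) := by linarith [y.2.1]
  by_cases h : (1 + y : ℝ) ≤ 1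
  · have : y = 0 := Subtype.ext (le_antisymm (by linarith : (y : ℝ) ≤ 0) y.2.1)
    subst this
    simp [lineMap]
  · simp [lineMap, h0, h]

/-- The affine path between two points of the line. -/
noncomputable def linePath (u v : ℝ) : Path u v where
  toFun x := u + x * (v - u)
  continuous_toFun := by fun_prop
  source' := by simp
  target' := by simp

/-- The path that runs through the whole of `lineMap`. -/
noncomputable def conjPath : Path b₀ b₁ :=
  ((linePath (-1) 2).map (lineMap l a r).continuous).cast
    (by simpa using (lineMap_neg l a r 1).symm)
    (by have := (lineMap_one_add l a r 1).symm; norm_num at this; exact this)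

theorem conjPath_apply (x : I) : conjPath l a r x = lineMap l a r (-1 + x * 3) := by
  simp only [conjPath, Path.cast_coe, Path.map_coe, Function.comp_apply, linePath, Path.coe_mk_mk]
  norm_num

/-- The line is simply connected, so the affine path from `-1` to `2` is homotopic to the
concatenation of its three unit pieces; `lineMap` carries this homotopy to `Y`. -/
theorem conjPath_homotopic : (conjPath l a r).Homotopic ((l.symm.trans a).trans r) := by
  have key := (SimplyConnectedSpace.paths_homotopic (linePath (-1) 2)
    (((linePath (-1) 0).trans (linePath 0 1)).trans (linePath 1 2))).map (lineMap l a r)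
  have h0 : b₀ = lineMap l a r (-1) := by simpa using (lineMap_neg l a r 1).symm
  have h1 : b₁ = lineMap l a r 2 := by
    have := (lineMap_one_add l a r 1).symm; norm_num at this; exact this
  have hcast := key.pathCast h0 h1
  have ha0 : a₀ = lineMap l a r 0 := by simpa using (lineMap_mid l a r 0).symm
  have ha1 : a₁ = lineMap l a r 1 := by simpa using (lineMap_mid l a r 1).symm
  have e : (((((linePath (-1) 0).trans (linePath 0 1)).trans (linePath 1 2)).map
      (lineMap l a r).continuous).cast h0 h1) = (l.symm.trans a).trans r := by
    rw [Path.map_trans, Path.map_trans]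
    have e1 : ((linePath (-1) 0).map (lineMap l a r).continuous).cast h0 ha0 = l.symm := by
      ext x
      change _ = l (σ x)
      rw [← lineMap_neg l a r]
      simp [linePath, sub_eq_neg_add]
    have e2 : ((linePath 0 1).map (lineMap l a r).continuous).cast ha0 ha1 = a := by
      ext x
      rw [← lineMap_mid l a r]
      simp [linePath]
    have e3 : ((linePath 1 2).map (lineMap l a r).continuous).cast ha1 h1 = r := by
      ext x
      rw [← lineMap_one_add l a r]
      simp only [linePath, Path.cast_coe, Path.map_coe, Function.comp_apply, Path.coe_mk_mk]
      norm_num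
    calc _ = (((((linePath (-1) 0).map (lineMap l a r).continuous).cast h0 ha0).trans
          (((linePath 0 1).map (lineMap l a r).continuous).cast ha0 ha1)).trans
          (((linePath 1 2).map (lineMap l a r).continuous).cast ha1 h1)) := rfl
      _ = _ := by rw [e1, e2, e3]
  rw [← e]
  exact hcast

/-- The square that moves `a` along `l` and `r`. -/
noncomputable def conjSquare : C(I × I, Y) :=
  -- At time `p.2` the first variable sweeps the segment from `-p.2` to `1 + p.2`, which grows from
  -- `[0, 1]` to `[-1, 2]`.
  (lineMap l a r).comp ⟨fun p => (1 + 2 * p.2) * p.1 - p.2, by fun_prop⟩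

end lineMap

namespace GraphSpace

variable {V E : Type*} [TopologicalSpace V] [DiscreteTopology V] [TopologicalSpace E]
  [DiscreteTopology E] {s t : E → V} {Y : Type*} [TopologicalSpace Y]

theorem eq_lift (f : C(GraphSpace s t, Y)) :
    f = lift (fun v => f (vert v)) fun e => (edge e).map f.continuous := by
  ext a
  revert a
  exact ind (fun _ => rfl) fun _ _ => rfl

open Path.Homotopic.Quotient in
/-- Maps `f` and `g` out of the realization are homotopic as soon as there are paths from
`f v` to `g v` for the vertices `v` that are compatible with the images of the edges. -/
theorem homotopic_of_tracks {f g : C(GraphSpace s t, Y)}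
    (τ : ∀ v, Path (f (vert v)) (g (vert v)))
    (h : ∀ e, (((edge e).map f.continuous).trans (τ (t e))).Homotopic
      ((τ (s e)).trans ((edge e).map g.continuous))) : f.Homotopic g := by
  -- The intermediate map has the vertices of `g` and the edges of `f` conjugated by the tracks.
  -- Sliding along the tracks leads from `f` to it; compatibility makes its edges path homotopic to
  -- those of `g`.
  let f' : C(GraphSpace s t, Y) := lift (fun v => g (vert v)) fun e =>
    conjPath (τ (s e)) ((edge e).map f.continuous) (τ (t e))
  have h1 : f.Homotopic f' := by
    refine homotopic_of_squares τ fun e =>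
      ⟨conjSquare (τ (s e)) ((edge e).map f.continuous) (τ (t e)), fun y => ?_, fun y => ?_,
        fun x => ?_, fun x => ?_⟩
    · refine Eq.trans ?_ (lineMap_neg (τ (s e)) ((edge e).map f.continuous) (τ (t e)) y)
      simp [conjSquare]
    · refine Eq.trans ?_ (lineMap_one_add (τ (s e)) ((edge e).map f.continuous) (τ (t e)) y)
      simp only [conjSquare, ContinuousMap.comp_apply, ContinuousMap.coe_mk]
      congr 1
      simp only [Set.Icc.coe_one]
      ring
    · have := lineMap_mid (τ (s e)) ((edge e).map f.continuous) (τ (t e)) x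
      simpa [conjSquare] using this
    · have := conjPath_apply (τ (s e)) ((edge e).map f.continuous) (τ (t e)) x
      simp only [f', lift_edge, this, conjSquare, ContinuousMap.comp_apply, ContinuousMap.coe_mk]
      congr 1
      simp only [Set.Icc.coe_one]
      ring
  refine h1.trans ?_
  rw [eq_lift g]
  refine homotopic_of_edges fun e => (conjPath_homotopic _ _ _).trans ?_
  have he := eq.mpr (h e)
  rw [← eq]
  rw [mk_trans, mk_trans] at he
  rw [mk_trans, mk_trans, mk_symm, trans_assoc, he, ← trans_assoc, symm_trans, refl_trans]

end GraphSpace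

/-! ### Collapsing a spanning tree -/

/-- Every edge of a rose goes from its only vertex to itself. -/
abbrev Rose (N : Type*) : Type _ := GraphSpace (fun _ : N => ()) (fun _ : N => ())

section SpanningTree

open GraphSpace Path.Homotopic.Quotient

variable {V N : Type*} [TopologicalSpace V] [DiscreteTopology V] [TopologicalSpace N]
  [DiscreteTopology N] {root : V} {par : {v : V // v ≠ root} → V} {sN tN : N → V}
  {rank : V → ℕ}

/-- The graph with the tree edges from `par v` to `v`, for `v ≠ root`, and the edges `N`. -/
abbrev TreeGraph (par : {v : V // v ≠ root} → V) (sN tN : N → V) : Type _ :=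
  GraphSpace (Sum.elim par sN) (Sum.elim Subtype.val tN)

/-- A tree edge, as a path. -/
def treeEdge (sN tN : N → V) (v : {v : V // v ≠ root}) :
    Path (vert (par v) : TreeGraph par sN tN) (vert v.1) :=
  edge (s := Sum.elim par sN) (t := Sum.elim Subtype.val tN) (Sum.inl v)

/-- One of the remaining edges, as a path. -/
def cycleEdge (par : {v : V // v ≠ root} → V) (sN tN : N → V) (k : N) :
    Path (vert (sN k) : TreeGraph par sN tN) (vert (tN k)) :=
  edge (s := Sum.elim par sN) (t := Sum.elim Subtype.val tN) (Sum.inr k)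

/-- The map that collapses the tree edges. -/
def collapse (par : {v : V // v ≠ root} → V) (sN tN : N → V) : C(TreeGraph par sN tN, Rose N) :=
  lift (fun _ => vert ()) fun e =>
    match e with
    | Sum.inl _ => Path.refl _
    | Sum.inr k => edge k

open Classical in
/-- The path from the root to `v` along tree edges. -/
noncomputable def treePath (sN tN : N → V)
    (hrank : ∀ v : {v : V // v ≠ root}, rank (par v) < rank v.1) (v : V) :
    Path (vert root : TreeGraph par sN tN) (vert v) :=
  if h : v ≠ root then
    (treePath sN tN hrank (par ⟨v, h⟩)).trans (treeEdge sN tN ⟨v, h⟩)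
  else (Path.refl _).cast rfl (by rw [not_not.mp h])
termination_by rank v
decreasing_by exact hrank ⟨v, h⟩

theorem treePath_trans (sN tN : N → V)
    (hrank : ∀ v : {v : V // v ≠ root}, rank (par v) < rank v.1) (v : {v : V // v ≠ root}) :
    treePath sN tN hrank v.1 = (treePath sN tN hrank (par v)).trans (treeEdge sN tN v) := by
  rw [treePath, dif_pos v.2]

theorem collapse_treePath (sN tN : N → V)
    (hrank : ∀ v : {v : V // v ≠ root}, rank (par v) < rank v.1) (v : V) :
    ((treePath sN tN hrank v).map (collapse par sN tN).continuous).Homotopic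
      (Path.refl (vert ())) := by
  induction hn : rank v using Nat.strong_induction_on generalizing v with
  | _ n ih =>
    by_cases h : v = root
    · subst h
      rw [treePath, dif_neg (not_not.mpr rfl)]
      exact Path.Homotopic.refl _
    · have h1 := ih _ (hn ▸ hrank ⟨v, h⟩) _ rfl
      rw [treePath_trans sN tN hrank ⟨v, h⟩, Path.map_trans]
      exact (h1.hcomp (Path.Homotopic.refl _)).trans (Path.Homotopic.trans_refl _)

theorem path_trans_symm_trans_cancel {X : Type*} [TopologicalSpace X] {w x y z : X}
    (a : Path w x) (b : Path x y) (c : Path z y) :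
    (((a.trans b).trans c.symm).trans c).Homotopic (a.trans b) := by
  rw [← eq, mk_trans, mk_trans, mk_symm, trans_assoc, symm_trans, trans_refl]

theorem path_trans_trans_symm_of_refl {X : Type*} [TopologicalSpace X] {x y : X}
    {a : Path x x} {b : Path x y} {c : Path y y} (ha : a.Homotopic (Path.refl x))
    (hc : c.Homotopic (Path.refl y)) : ((a.trans b).trans c.symm).Homotopic b := by
  rw [← eq] at ha hc ⊢
  rw [mk_trans, mk_trans, mk_symm, ha, hc, mk_refl, refl_trans, ← mk_symm,
    Path.refl_symm, mk_refl, trans_refl]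

/-- A graph with a spanning tree is homotopy equivalent to the rose on its remaining edges. -/
theorem treeGraph_homotopyEquiv_rose (par : {v : V // v ≠ root} → V) (sN tN : N → V)
    (hrank : ∀ v : {v : V // v ≠ root}, rank (par v) < rank v.1) :
    Nonempty (ContinuousMap.HomotopyEquiv (TreeGraph par sN tN) (Rose N)) := by
  let γ := treePath sN tN hrank
  -- The homotopy inverse sends a petal to its edge, reached from the root and left again through
  -- the tree.
  let P : C(Rose N, TreeGraph par sN tN) := lift (fun _ => vert root) fun k =>
    ((γ (sN k)).trans (cycleEdge par sN tN k)).trans (γ (tN k)).symm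
  refine ⟨⟨collapse par sN tN, P, ?_, ?_⟩⟩
  · refine homotopic_of_tracks (fun v => γ v) fun e => ?_
    rcases e with v | k
    · have h : (γ v.1).Homotopic ((γ (par v)).trans (treeEdge sN tN v)) := by
        rw [← treePath_trans sN tN hrank v]
      exact (Path.Homotopic.refl_trans (γ v.1)).trans h
    · exact path_trans_symm_trans_cancel (γ (sN k)) (cycleEdge par sN tN k) (γ (tN k))
  · refine homotopic_of_tracks (fun v => Path.refl _) fun k => ?_
    have h : ((((γ (sN k)).trans (cycleEdge par sN tN k)).trans (γ (tN k)).symm).map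
        (collapse par sN tN).continuous).Homotopic (edge k) := by
      rw [Path.map_trans, Path.map_trans, ← Path.map_symm]
      exact path_trans_trans_symm_of_refl (b := edge k)
        (collapse_treePath sN tN hrank (sN k)) (collapse_treePath sN tN hrank (tN k))
    exact ((h.hcomp (Path.Homotopic.refl _)).trans (Path.Homotopic.trans_refl _)).trans
      (Path.Homotopic.refl_trans _).symm

end SpanningTree

/-! ### Recognizing graphs; the wedge of circles as a rose -/

namespace GraphSpace

variable {V E : Type*} [TopologicalSpace V] [DiscreteTopology V] [TopologicalSpace E]
  [DiscreteTopology E] {s t : E → V} {Y : Type*} [TopologicalSpace Y]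

instance [Finite V] [Finite E] : CompactSpace (GraphSpace s t) :=
  inferInstanceAs (CompactSpace (Quot (GraphRel s t)))

theorem edge_zero (e : E) : (edge e 0 : GraphSpace s t) = vert (s e) := (edge e).source

theorem edge_one (e : E) : (edge e 1 : GraphSpace s t) = vert (t e) := (edge e).target

/-- Coincidences are allowed only at ends of edges; these are vertices, where injectivity of `φ`
decides. For a finite graph and a Hausdorff target, the resulting continuous bijection is a
homeomorphism by compactness. -/
theorem lift_bijective {φ : V → Y} {ψ : ∀ e, Path (φ (s e)) (φ (t e))}
    (hφ : Function.Injective φ) (hvert : ∀ e x v, ψ e x = φ v → x = 0 ∨ x = 1)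
    (hedge : ∀ e x e' x', ψ e x = ψ e' x' → (x = 0 ∨ x = 1) ∨ (e = e' ∧ x = x'))
    (hsurj : ∀ y, (∃ v, φ v = y) ∨ ∃ e x, ψ e x = y) : Function.Bijective (lift φ ψ) := by
  have end_eq : ∀ (e : E) (x : I), x = 0 ∨ x = 1 → ∃ v, (edge e x : GraphSpace s t) = vert v := by
    rintro e x (rfl | rfl)
    · exact ⟨_, edge_zero e⟩
    · exact ⟨_, edge_one e⟩
  have hve : ∀ e x v, lift φ ψ (edge e x) = lift φ ψ (vert v) →
      (edge e x : GraphSpace s t) = vert v := by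
    intro e x v h
    obtain ⟨w, hw⟩ := end_eq e x (hvert e x v h)
    rw [hw] at h ⊢
    rw [show w = v from hφ h]
  refine ⟨fun a a' => ?_, fun y => ?_⟩
  · revert a
    refine ind (fun v => ?_) fun e x => ?_ <;> revert a'
    · refine ind (fun v' h => ?_) fun e x h => (hve e x v h.symm).symm
      rw [show v = v' from hφ h]
    · refine ind (fun v' h => hve e x v' h) fun e' x' h => ?_
      rcases hedge e x e' x' h with hx | ⟨rfl, rfl⟩
      · obtain ⟨w, hw⟩ := end_eq e x hx
        rw [hw] at h ⊢
        exact (hve e' x' w h.symm).symm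
      · rfl
  · rcases hsurj y with ⟨v, rfl⟩ | ⟨e, x, rfl⟩
    · exact ⟨vert v, rfl⟩
    · exact ⟨edge e x, rfl⟩

end GraphSpace

section Wedge

open GraphSpace

/-- The point of the torus that has the coordinate `z` on the circle `k` of the wedge. -/
noncomputable def wedgeCoord {N : ℕ} : WedgeOfCircles N → Fin N → Circle :=
  Quot.lift (Sum.elim (fun _ => 1) fun p => Pi.mulSingle p.1 p.2) (by
    rintro _ _ ⟨k⟩
    exact Pi.mulSingle_one k)

theorem continuous_wedgeCoord (N : ℕ) : Continuous (wedgeCoord (N := N)) := by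
  refine continuous_quot_lift _ (continuous_sum_dom.mpr ⟨continuous_const, ?_⟩)
  exact continuous_prod_of_discrete_left.mpr fun k =>
    continuous_mulSingle (A := fun _ : Fin N => Circle) k

/-- Mapping the wedge onto the coordinate circles of a torus serves to show that it is Hausdorff. -/
theorem wedgeCoord_injective (N : ℕ) : Function.Injective (wedgeCoord (N := N)) := by
  have h1 : ∀ (k : Fin N), (Quot.mk _ (Sum.inr (k, 1)) : WedgeOfCircles N) =
    Quot.mk _ (Sum.inl ()) := fun k => Quot.sound (WedgeRel.glue k)
  have h2 : ∀ (k : Fin N) (z : Circle), (Pi.mulSingle k z : Fin N → Circle) = 1 → z = 1 :=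
    fun k z h => by simpa using congrFun h k
  rintro ⟨⟨⟩ | ⟨k, z⟩⟩ ⟨⟨⟩ | ⟨k', z'⟩⟩ h
  · rfl
  · rw [h2 k' z' h.symm]
    exact (h1 k').symm
  · rw [h2 k z h]
    exact h1 k
  · have h : (Pi.mulSingle k z : Fin N → Circle) = Pi.mulSingle k' z' := h
    by_cases hk : k = k'
    · subst hk
      rw [Pi.mulSingle_injective k h]
    · have hz := congrFun h k
      have hz' := congrFun h k'
      simp only [Pi.mulSingle_eq_same, Pi.mulSingle_eq_of_ne hk,
        Pi.mulSingle_eq_of_ne (Ne.symm hk)] at hz hz'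
      rw [hz, ← hz']
      exact (h1 k).trans (h1 k').symm

instance (N : ℕ) : T2Space (WedgeOfCircles N) :=
  T2Space.of_injective_continuous (wedgeCoord_injective N) (continuous_wedgeCoord N)

/-- The loop around the circle `k` of the wedge. -/
noncomputable def wedgeLoop {N : ℕ} (k : Fin N) :
    Path (Quot.mk _ (Sum.inl ()) : WedgeOfCircles N) (Quot.mk _ (Sum.inl ())) where
  toFun x := Quot.mk _ (Sum.inr (k, Circle.exp (2 * Real.pi * x)))
  continuous_toFun := continuous_quot_mk.comp (by fun_prop)
  source' := by
    simp only [Set.Icc.coe_zero, mul_zero, Circle.exp_zero]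
    exact Quot.sound (WedgeRel.glue k)
  target' := by
    simp only [Set.Icc.coe_one, mul_one, Circle.exp_two_pi]
    exact Quot.sound (WedgeRel.glue k)

/-- The two parameters differ by `-1`, `0` or `1`, and a nonzero difference forces both to be ends
of the interval. -/
theorem circle_exp_injective_interior {x y : I}
    (h : Circle.exp (2 * Real.pi * x) = Circle.exp (2 * Real.pi * y)) :
    (x = 0 ∨ x = 1) ∨ x = y := by
  obtain ⟨n, hn⟩ := Circle.exp_eq_exp.mp h
  have hxy : (x : ℝ) = y + n := by
    have := Real.pi_pos
    field_simp at hn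
    linarith
  have hx := x.2
  have hy := y.2
  have h1 : (n : ℝ) ≤ 1 := by linarith [hx.2, hy.1]
  have h2 : (-1 : ℝ) ≤ n := by linarith [hx.1, hy.2]
  have h1' : n ≤ 1 := by exact_mod_cast h1
  have h2' : -1 ≤ n := by exact_mod_cast h2
  obtain rfl | rfl | rfl : n = -1 ∨ n = 0 ∨ n = 1 := by omega
  · refine Or.inl (Or.inl (Subtype.ext ?_))
    push_cast at hxy
    have : (x : ℝ) = 0 := by linarith [hx.1, hy.2]
    simpa using this
  · exact Or.inr (Subtype.ext (by simpa using hxy))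
  · refine Or.inl (Or.inr (Subtype.ext ?_))
    push_cast at hxy
    have : (x : ℝ) = 1 := by linarith [hx.2, hy.1]
    simpa using this

theorem exists_circle_exp_eq (z : Circle) : ∃ x : I, Circle.exp (2 * Real.pi * x) = z := by
  -- The argument may be negative, hence the reduction modulo `1`.
  let a := Complex.arg z / (2 * Real.pi)
  refine ⟨⟨Int.fract a, Int.fract_nonneg a, (Int.fract_lt_one a).le⟩, ?_⟩
  conv_rhs => rw [← Circle.exp_arg z]
  rw [Circle.exp_eq_exp]
  refine ⟨-⌊a⌋, ?_⟩
  have : (2 * Real.pi) * a = Complex.arg z := by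
    have := Real.pi_pos
    simp only [a]
    field_simp
  rw [← this]
  change 2 * Real.pi * Int.fract a = _
  rw [← Int.self_sub_floor]
  push_cast
  ring

/-- The wedge of circles is the rose. -/
theorem rose_homeomorph_wedge {M : Type*} [TopologicalSpace M] [DiscreteTopology M] {N : ℕ}
    (ε : M ≃ Fin N) : Nonempty (Rose M ≃ₜ WedgeOfCircles N) := by
  have : Finite M := Finite.of_equiv _ ε.symm
  have hb : Function.Bijective (lift (s := fun _ : M => ()) (t := fun _ : M => ())
      (fun _ => (Quot.mk _ (Sum.inl ()) : WedgeOfCircles N)) fun k => wedgeLoop (ε k)) := by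
    refine lift_bijective (fun _ _ _ => rfl) ?_ ?_ ?_
    · intro k x _ h
      have h' : (Pi.mulSingle (ε k) (Circle.exp (2 * Real.pi * x)) : Fin N → Circle) = 1 :=
        congrArg wedgeCoord h
      have h'' : Circle.exp (2 * Real.pi * x) = 1 := by simpa using congrFun h' (ε k)
      rcases circle_exp_injective_interior (x := x) (y := 0) (by simpa using h'') with hx | hx
      · exact hx
      · exact Or.inl hx
    · intro k x k' x' h
      have h' : (Pi.mulSingle (ε k) (Circle.exp (2 * Real.pi * x)) : Fin N → Circle) =
        Pi.mulSingle (ε k') (Circle.exp (2 * Real.pi * x')) := congrArg wedgeCoord h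
      by_cases hk : k = k'
      · subst hk
        exact (circle_exp_injective_interior
          (Pi.mulSingle_injective (M := fun _ : Fin N => Circle) (ε k) h')).imp_right
            fun hx => ⟨rfl, hx⟩
      · have hz := congrFun h' (ε k)
        rw [Pi.mulSingle_eq_same, Pi.mulSingle_eq_of_ne (ε.injective.ne hk)] at hz
        rcases circle_exp_injective_interior (x := x) (y := 0) (by simpa using hz) with hx | hx
        · exact Or.inl hx
        · exact Or.inl (Or.inl hx)
    · rintro ⟨⟨⟩ | ⟨k, z⟩⟩
      · exact Or.inl ⟨(), rfl⟩
      · obtain ⟨x, rfl⟩ := exists_circle_exp_eq z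
        refine Or.inr ⟨ε.symm k, x, ?_⟩
        rw [Equiv.apply_symm_apply]
        rfl
  exact ⟨Continuous.homeoOfEquivCompactToT2 (f := Equiv.ofBijective _ hb)
    (ContinuousMap.continuous _)⟩

end Wedge

/-! ### The grid as a graph with a spanning tree -/

theorem mem_polyhedralProduct_discreteComplex {r : ℕ} {X : Fin r → Type*} {A : ∀ i, Set (X i)}
    {x : ∀ i, X i} : x ∈ polyhedralProduct (discreteComplex r) A ↔
      (∀ i, x i ∈ A i) ∨ ∃ i, ∀ j ≠ i, x j ∈ A j := by
  simp only [polyhedralProduct, discreteComplex, Set.mem_iUnion, Set.mem_insert_iff,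
    Set.mem_ofPred_eq, exists_prop]
  constructor
  · rintro ⟨_, rfl | ⟨v, rfl⟩, h⟩
    · exact Or.inl fun i => h i (by simp)
    · exact Or.inr ⟨v, fun j hj => h j (by simpa using hj)⟩
  · rintro (h | ⟨i, h⟩)
    · exact ⟨∅, Or.inl rfl, fun i _ => h i⟩
    · exact ⟨{i}, Or.inr ⟨i, rfl⟩, fun j hj => h j (by simpa using hj)⟩

section Grid

/-- The integers in the interval `[0, n - 1]`. -/
def gridPoints (n : ℕ) : Set (Set.Icc (0 : ℝ) ((n : ℝ) - 1)) :=
  {x | ∃ k : ℕ, (x : ℝ) = k}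

/-- An element of `Fin n`, as a point of the interval `[0, n - 1]`. -/
def gridPoint {n : ℕ} (k : Fin n) : Set.Icc (0 : ℝ) ((n : ℝ) - 1) :=
  ⟨(k : ℕ), Nat.cast_nonneg _, by
    have : ((k : ℕ) + 1 : ℝ) ≤ n := by exact_mod_cast k.2
    linarith⟩

theorem gridPoint_mem {n : ℕ} (k : Fin n) : gridPoint k ∈ gridPoints n := ⟨k, rfl⟩

theorem gridPoint_injective {n : ℕ} : Function.Injective (gridPoint (n := n)) := fun k l h => by
  have : ((k : ℕ) : ℝ) = (l : ℕ) := congrArg Subtype.val h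
  exact Fin.ext (by exact_mod_cast this)

theorem exists_gridPoint {n : ℕ} {x : Set.Icc (0 : ℝ) ((n : ℝ) - 1)} (h : x ∈ gridPoints n) :
    ∃ k : Fin n, gridPoint k = x := by
  obtain ⟨k, hk⟩ := h
  have h1 : (k : ℝ) + 1 ≤ n := by linarith [x.2.2]
  exact ⟨⟨k, by exact_mod_cast h1⟩, Subtype.ext hk.symm⟩

variable {r : ℕ} {m : Fin r → ℕ} [∀ i, NeZero (m i)]

/-- The union of the grid lines in a box. -/
abbrev GridSpace (m : Fin r → ℕ) : Type :=
  polyhedralProduct (discreteComplex r) fun i => gridPoints (m i)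

/-- The base point of the box of indices. -/
abbrev gridRoot (m : Fin r → ℕ) [∀ i, NeZero (m i)] : ∀ i, Fin (m i) := fun _ => 0

/-- The grid point with given coordinates. -/
def gridVert (q : ∀ i, Fin (m i)) : GridSpace m :=
  ⟨fun i => gridPoint (q i), mem_polyhedralProduct_discreteComplex.mpr
    (Or.inl fun i => gridPoint_mem (q i))⟩

/-- Decreases the coordinate `i` by one. -/
def gridDec (i : Fin r) (q : ∀ i, Fin (m i)) : ∀ i, Fin (m i) :=
  -- Truncated subtraction fixes `q` if `q i = 0`; the edges of the graph use only `q i ≠ 0`.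
  Function.update q i ⟨(q i : ℕ) - 1, (Nat.sub_le _ _).trans_lt (q i).2⟩

theorem one_le_of_ne {n : ℕ} [NeZero n] {k : Fin n} (h : k ≠ 0) : (1 : ℝ) ≤ ((k : ℕ) : ℝ) := by
  exact_mod_cast Nat.one_le_iff_ne_zero.mpr fun h0 => h (Fin.ext h0)

/-- The point at distance `1 - x` below `k` in the interval. -/
def gridBelow {n : ℕ} [NeZero n] {k : Fin n} (h : k ≠ 0) (x : I) :
    Set.Icc (0 : ℝ) ((n : ℝ) - 1) :=
  ⟨(k : ℕ) - 1 + x, by linarith [x.2.1, one_le_of_ne h], by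
    linarith [x.2.2, (gridPoint k).2.2, show (gridPoint k : ℝ) = (k : ℕ) from rfl]⟩

/-- The edge of the grid that ends at `q` and is parallel to the axis `i`. -/
def gridPath (i : Fin r) (q : ∀ i, Fin (m i)) (h : q i ≠ 0) :
    Path (gridVert (gridDec i q)) (gridVert q) where
  toFun x := ⟨Function.update (fun j => gridPoint (q j)) i (gridBelow h x),
    mem_polyhedralProduct_discreteComplex.mpr (Or.inr ⟨i, fun j hj => by
      rw [Function.update_of_ne hj]
      exact gridPoint_mem (q j)⟩)⟩
  continuous_toFun := by
    refine Continuous.subtype_mk (continuous_const.update i ?_) _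
    exact Continuous.subtype_mk (by fun_prop) _
  source' := by
    refine Subtype.ext (funext fun j => ?_)
    by_cases hj : j = i
    · subst hj
      have : 1 ≤ (q j : ℕ) := by exact_mod_cast one_le_of_ne h
      simp [gridVert, gridDec, gridBelow, gridPoint, Nat.cast_sub this]
    · simp [gridVert, gridDec, hj]
  target' := by
    refine Subtype.ext (funext fun j => ?_)
    by_cases hj : j = i
    · subst hj
      simp [gridVert, gridBelow, gridPoint]
    · simp [gridVert, hj]

theorem gridPath_apply_same (i : Fin r) (q : ∀ i, Fin (m i)) (h : q i ≠ 0) (x : I) :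
    ((gridPath i q h x).1 i : ℝ) = (q i : ℕ) - 1 + x := by
  simp [gridPath, gridBelow]

theorem gridPath_apply_of_ne {i : Fin r} (q : ∀ i, Fin (m i)) (h : q i ≠ 0) (x : I) {j : Fin r}
    (hj : j ≠ i) : (gridPath i q h x).1 j = gridPoint (q j) := by
  simp [gridPath, hj]

theorem eq_zero_or_one_of_eq_nat {k l : ℕ} {x : I} (h : (k : ℝ) - 1 + x = l) :
    x = 0 ∨ x = 1 := by
  have h1 : (l : ℝ) ≤ k := by linarith [x.2.2]
  have h2 : (k : ℝ) ≤ l + 1 := by linarith [x.2.1]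
  have h1' : l ≤ k := by exact_mod_cast h1
  have h2' : k ≤ l + 1 := by exact_mod_cast h2
  obtain rfl | rfl : k = l ∨ k = l + 1 := by omega
  · exact Or.inr (Subtype.ext (by simp only [Set.Icc.coe_one]; linarith))
  · refine Or.inl (Subtype.ext ?_)
    push_cast at h
    simp only [Set.Icc.coe_zero]
    linarith

theorem gridPath_eq_gridVert {i : Fin r} {q : ∀ i, Fin (m i)} {h : q i ≠ 0} {x : I}
    {v : ∀ i, Fin (m i)} (e : gridPath i q h x = gridVert v) : x = 0 ∨ x = 1 := by
  have := gridPath_apply_same i q h x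
  rw [e] at this
  exact eq_zero_or_one_of_eq_nat this.symm

/-- Distinct unit segments meet only in grid points: parallel ones share at most an end, and on a
segment of another direction the `i`-th coordinate is a constant integer. -/
theorem gridPath_eq_gridPath {i i' : Fin r} {q q' : ∀ i, Fin (m i)} {h : q i ≠ 0} {h' : q' i' ≠ 0}
    {x x' : I} (e : gridPath i q h x = gridPath i' q' h' x') :
    (x = 0 ∨ x = 1) ∨ (i = i' ∧ q = q' ∧ x = x') := by
  have h1 := gridPath_apply_same i q h x
  by_cases hi : i = i'
  · subst hi
    rw [e, gridPath_apply_same] at h1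
    have hq : ∀ j, j ≠ i → q j = q' j := fun j hj => gridPoint_injective <| by
      rw [← gridPath_apply_of_ne q h x hj, e, gridPath_apply_of_ne q' h' x' hj]
    by_cases hqi : q i = q' i
    · refine Or.inr ⟨rfl, funext fun j => ?_, Subtype.ext ?_⟩
      · by_cases hj : j = i
        · rw [hj, hqi]
        · exact hq j hj
      · rw [hqi] at h1
        linarith
    · left
      have hne : (q i : ℕ) ≠ q' i := fun hh => hqi (Fin.ext hh)
      rcases lt_or_gt_of_ne hne with hlt | hlt
      · have : ((q i : ℕ) : ℝ) + 1 ≤ (q' i : ℕ) := by exact_mod_cast hlt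
        right
        apply Subtype.ext
        simp only [Set.Icc.coe_one]
        linarith [x.2.2, x'.2.1]
      · have : ((q' i : ℕ) : ℝ) + 1 ≤ (q i : ℕ) := by exact_mod_cast hlt
        left
        apply Subtype.ext
        simp only [Set.Icc.coe_zero]
        linarith [x.2.1, x'.2.2]
  · rw [e, gridPath_apply_of_ne q' h' x' hi] at h1
    exact Or.inl (eq_zero_or_one_of_eq_nat h1.symm)

theorem exists_gridPath_eq (y : GridSpace m) :
    (∃ v, gridVert v = y) ∨ ∃ i q, ∃ h : q i ≠ 0, ∃ x, gridPath i q h x = y := by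
  by_cases hall : ∀ i, y.1 i ∈ gridPoints (m i)
  · choose v hv using fun i => exists_gridPoint (hall i)
    exact Or.inl ⟨v, Subtype.ext (funext hv)⟩
  · right
    obtain ⟨i, hi⟩ := (mem_polyhedralProduct_discreteComplex.mp y.2).resolve_left hall
    have hyi : y.1 i ∉ gridPoints (m i) := fun h => hall fun j => by
      by_cases hj : j = i
      · rwa [hj]
      · exact hi j hj
    choose! v hv using fun j hj => exists_gridPoint (hi j hj)
    set z : ℝ := (y.1 i : ℝ) with hz
    have hz0 : 0 ≤ z := (y.1 i).2.1
    have hz1 : z ≤ m i - 1 := (y.1 i).2.2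
    have hm : 0 < m i := Nat.pos_of_ne_zero (NeZero.ne _)
    have hceil : ⌈z⌉₊ < m i := by
      have : ⌈z⌉₊ ≤ m i - 1 := Nat.ceil_le.mpr (by rw [Nat.cast_sub hm]; simpa using hz1)
      omega
    have hzpos : 0 < z := lt_of_le_of_ne hz0 fun h => hyi ⟨0, by simp [← hz, ← h]⟩
    -- An edge is named by its upper end, so the only nonintegral coordinate is rounded up.
    let q : ∀ j, Fin (m j) := Function.update v i ⟨⌈z⌉₊, hceil⟩
    have hqi : q i = ⟨⌈z⌉₊, hceil⟩ := Function.update_self _ _ _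
    refine ⟨i, q, ?_, ⟨z - ⌈z⌉₊ + 1, ?_, ?_⟩, Subtype.ext (funext fun j => ?_)⟩
    · rw [hqi]
      intro h
      have : ⌈z⌉₊ = 0 := by simpa using congrArg Fin.val h
      exact absurd (Nat.ceil_eq_zero.mp this) (not_le.mpr hzpos)
    · linarith [Nat.ceil_lt_add_one hz0]
    · linarith [Nat.le_ceil z]
    · by_cases hj : j = i
      · subst hj
        apply Subtype.ext
        rw [gridPath_apply_same, hqi]
        simp [← hz]
      · rw [gridPath_apply_of_ne _ _ _ hj, ← hv j hj]
        simp [q, hj]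

open GraphSpace

/-- The graph of the grid, with the spanning tree whose edges decrease the first positive
coordinate. -/
abbrev GridGraph (m : Fin r → ℕ) [∀ i, NeZero (m i)] : Type :=
  TreeGraph (root := gridRoot m) (fun v => gridDec (firstIndex v.2) v.1)
    (fun k : ExtraEdge (gridRoot m) => gridDec k.1.1 k.1.2) (fun k => k.1.2)

theorem gridGraph_homeomorph (m : Fin r → ℕ) [∀ i, NeZero (m i)] :
    Nonempty (GridGraph m ≃ₜ GridSpace m) := by
  let φ : (∀ i, Fin (m i)) → GridSpace m := gridVert
  let ψ : ∀ e : {v // v ≠ gridRoot m} ⊕ ExtraEdge (gridRoot m),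
      Path (φ (Sum.elim (fun v => gridDec (firstIndex v.2) v.1) (fun k => gridDec k.1.1 k.1.2) e))
        (φ (Sum.elim Subtype.val (fun k => k.1.2) e)) := fun e =>
    match e with
    | Sum.inl v => gridPath (firstIndex v.2) v.1 (firstIndex_ne v.2)
    | Sum.inr k => gridPath k.1.1 k.1.2 k.2.1
  have hb : Function.Bijective (lift φ ψ) := by
    refine lift_bijective ?_ ?_ ?_ ?_
    · intro v w h
      exact funext fun i => gridPoint_injective (congrFun (congrArg Subtype.val h) i)
    · rintro (v | k) x w h
      · exact gridPath_eq_gridVert h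
      · exact gridPath_eq_gridVert h
    · rintro (v | k) x (v' | k') x' h
      · refine (gridPath_eq_gridPath h).imp_right ?_
        rintro ⟨-, hq, hx⟩
        exact ⟨congrArg _ (Subtype.ext hq), hx⟩
      · refine (gridPath_eq_gridPath h).imp_right ?_
        rintro ⟨hi, hq, hx⟩
        obtain ⟨⟨i, q⟩, h1, j, hj, hne⟩ := k'
        -- A tree edge has only zeros before its index, an extra edge has a nonzero coordinate
        -- there.
        exact absurd (hq ▸ eq_of_lt_firstIndex v.2 (hi.symm ▸ hj)) hne
      · refine (gridPath_eq_gridPath h).imp_right ?_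
        rintro ⟨hi, hq, hx⟩
        obtain ⟨⟨i, q⟩, h1, j, hj, hne⟩ := k
        exact absurd (hq ▸ eq_of_lt_firstIndex v'.2 (hi ▸ hj)) hne
      · refine (gridPath_eq_gridPath h).imp_right ?_
        rintro ⟨hi, hq, hx⟩
        exact ⟨congrArg _ (Subtype.ext (Prod.ext hi hq)), hx⟩
    · intro y
      refine (exists_gridPath_eq y).imp_right ?_
      rintro ⟨i, q, h, x, hy⟩
      by_cases hex : ∃ j < i, q j ≠ 0
      · exact ⟨Sum.inr ⟨(i, q), h, hex⟩, x, hy⟩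
      · have hq : q ≠ gridRoot m := fun e => h (congrFun e i)
        have hf : firstIndex hq = i := firstIndex_eq hq h fun j hj => by
          by_contra hne
          exact hex ⟨j, hj, hne⟩
        refine ⟨Sum.inl ⟨q, hq⟩, x, ?_⟩
        subst hf
        exact hy
  exact ⟨Continuous.homeoOfEquivCompactToT2 (f := Equiv.ofBijective _ hb)
    (ContinuousMap.continuous _)⟩

/-- The coordinate sum is the rank that makes the descent to the root terminate. -/
theorem sum_gridDec_lt {i : Fin r} {q : ∀ i, Fin (m i)} (h : q i ≠ 0) :
    ∑ j, (gridDec i q j : ℕ) < ∑ j, (q j : ℕ) := by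
  have h1 : (q i : ℕ) ≠ 0 := fun h' => h (Fin.ext h')
  refine Finset.sum_lt_sum (fun j _ => ?_) ⟨i, Finset.mem_univ i, ?_⟩
  · by_cases hj : j = i
    · subst hj
      simp [gridDec]
    · simp [gridDec, hj]
  · simp only [gridDec, Function.update_self]
    omega

theorem gridSpace_homotopyEquiv_wedge (m : Fin r → ℕ) [∀ i, NeZero (m i)] :
    Nonempty (ContinuousMap.HomotopyEquiv (GridSpace m) (WedgeOfCircles (circleCount r m))) := by
  obtain ⟨e₁⟩ := gridGraph_homeomorph m
  obtain ⟨e₂⟩ := treeGraph_homotopyEquiv_rose (root := gridRoot m)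
    (fun v => gridDec (firstIndex v.2) v.1)
    (fun k : ExtraEdge (gridRoot m) => gridDec k.1.1 k.1.2) (fun k => k.1.2)
    (rank := fun q => ∑ j, (q j : ℕ)) fun v => sum_gridDec_lt (firstIndex_ne v.2)
  have hcard : Nat.card (ExtraEdge (gridRoot m)) = circleCount r m := by
    rw [card_extraEdge]
    simp
  obtain ⟨e₃⟩ := rose_homeomorph_wedge (hcard ▸ Finite.equivFin (ExtraEdge (gridRoot m)))
  exact ⟨(e₁.symm.toHomotopyEquiv.trans e₂).trans e₃.toHomotopyEquiv⟩

end Grid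

/-! ### Lifting properties against discs -/

section Discs

open Metric Set

/-- Maps on cells are total functions, continuous on a subset; this passes to them from maps on a
subtype, with an arbitrary constant value outside. -/
theorem exists_extend_restrict {X Y : Type*} [TopologicalSpace X] [TopologicalSpace Y] {K : Set X}
    (hK : K.Nonempty) (k : C(K, Y)) : ∃ g : X → Y, ContinuousOn g K ∧ ∀ x : K, g x = k x := by
  refine ⟨Function.extend Subtype.val k fun _ => k ⟨_, hK.choose_spec⟩, ?_, fun x =>
    Subtype.val_injective.extend_apply _ _ x⟩
  rw [continuousOn_iff_continuous_domRestrict]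
  convert! k.continuous using 1
  exact funext fun x => Subtype.val_injective.extend_apply _ _ x

/-- A map from the unit sphere to a contractible space extends over the ball. -/
theorem exists_extension_closedBall {V : Type*} [NormedAddCommGroup V] [NormedSpace ℝ V]
    [FiniteDimensional ℝ V] {E : Type*} [TopologicalSpace E] [ContractibleSpace E] {f : V → E}
    (hf : ContinuousOn f (sphere 0 1)) :
    ∃ g : V → E, ContinuousOn g (closedBall 0 1) ∧ EqOn g f (sphere 0 1) := by
  obtain ⟨e₀, ⟨H⟩⟩ := id_nullhomotopic E
  rcases (sphere (0 : V) 1).eq_empty_or_nonempty with hS | ⟨b₀, hb₀⟩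
  · exact ⟨fun _ => e₀, continuousOn_const, by rw [hS]; exact eqOn_empty _ _⟩
  have : ProperSpace V := FiniteDimensional.proper ℝ V
  have norm_eq : ∀ b : sphere (0 : V) 1, ‖(b : V)‖ = 1 := fun b => by simp
  -- Polar coordinates present the ball as a quotient of the cylinder over the sphere.
  let π : C(sphere (0 : V) 1 × I, closedBall (0 : V) 1) :=
    ⟨fun p => ⟨(p.2 : ℝ) • (p.1 : V), by
      rw [mem_closedBall_zero_iff, norm_smul, norm_eq, mul_one, Real.norm_of_nonneg p.2.2.1]
      exact p.2.2.2⟩, by fun_prop⟩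
  have norm_π : ∀ p, ‖(π p : V)‖ = p.2 := fun p => by
    change ‖(p.2 : ℝ) • (p.1 : V)‖ = p.2
    rw [norm_smul, norm_eq, mul_one, Real.norm_of_nonneg p.2.2.1]
  have hsurj : Function.Surjective π := by
    rintro ⟨x, hx⟩
    by_cases h0 : x = 0
    · exact ⟨(⟨b₀, hb₀⟩, 0), Subtype.ext (by simp [π, h0])⟩
    · have hn : ‖x‖ ≠ 0 := norm_ne_zero_iff.mpr h0
      refine ⟨(⟨‖x‖⁻¹ • x, ?_⟩, ⟨‖x‖, norm_nonneg _, by simpa using hx⟩), Subtype.ext ?_⟩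
      · simp [norm_smul, hn]
      · simp [π, smul_smul, hn]
  have hquot : IsQuotientMap π := π.continuous.isClosedMap.isQuotientMap π.continuous hsurj
  -- The contraction runs inwards: `f` at radius `1` and the constant `e₀` at radius `0`, so `F`
  -- descends to the ball.
  let F : C(sphere (0 : V) 1 × I, E) :=
    ⟨fun p => H (σ p.2, f p.1), H.continuous.comp ((by fun_prop : Continuous fun p :
      sphere (0 : V) 1 × I => σ p.2).prodMk
        ((continuousOn_iff_continuous_domRestrict.mp hf).comp continuous_fst))⟩
  have hF : ∀ p p', π p = π p' → F p = F p' := by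
    rintro ⟨b, x⟩ ⟨b', x'⟩ h
    have hx : x = x' := Subtype.ext <| by
      rw [← norm_π (b, x), ← norm_π (b', x'), h]
    subst hx
    by_cases h0 : x = 0
    · subst h0
      simp [F]
    · have h0' : (x : ℝ) ≠ 0 := fun h' => h0 (Subtype.ext h')
      have hb : b = b' := Subtype.ext (smul_right_injective V h0' (congrArg Subtype.val h))
      rw [hb]
  let G : C(closedBall (0 : V) 1, E) := hquot.lift F hF
  obtain ⟨g, hg, hgG⟩ := exists_extend_restrict ⟨0, by simp⟩ G
  refine ⟨g, hg, fun b hb => ?_⟩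
  have hπ : π (⟨b, hb⟩, 1) = ⟨b, sphere_subset_closedBall hb⟩ := Subtype.ext (by simp [π])
  have h1 : G (π (⟨b, hb⟩, 1)) = F (⟨b, hb⟩, 1) :=
    DFunLike.congr_fun (hquot.lift_comp F hF) ((⟨b, hb⟩ : sphere (0 : V) 1), (1 : I))
  have h2 := hgG ⟨b, sphere_subset_closedBall hb⟩
  rw [← hπ, h1] at h2
  simpa [F, hπ] using h2

/-- `p` has the right lifting property against the inclusions of spheres in discs. -/
def HasDiscLifting {P B : Type*} [TopologicalSpace P] [TopologicalSpace B] (p : P → B) : Prop :=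
  ∀ (n : ℕ) (f : (Fin n → ℝ) → P) (b : (Fin n → ℝ) → B), ContinuousOn f (sphere 0 1) →
    ContinuousOn b (closedBall 0 1) → (∀ x ∈ sphere 0 1, p (f x) = b x) →
    ∃ g : (Fin n → ℝ) → P, ContinuousOn g (closedBall 0 1) ∧ EqOn g f (sphere 0 1) ∧
      ∀ x ∈ closedBall 0 1, p (g x) = b x

theorem hasDiscLifting_const (P : Type*) [TopologicalSpace P] [ContractibleSpace P] :
    HasDiscLifting fun _ : P => () := by
  intro n f b hf _ _
  obtain ⟨g, hg, hgf⟩ := exists_extension_closedBall hf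
  exact ⟨g, hg, hgf, fun _ _ => rfl⟩

/-- A family of paths over the disc is a map on disc times interval. The prescribed ends and the
paths over the sphere define it on the boundary, which in the sup norm is the unit sphere of `(Fin n
→ ℝ) × ℝ`; so it extends over the ball of one dimension more. -/
theorem hasDiscLifting_endpoints (E : Type*) [TopologicalSpace E] [ContractibleSpace E] :
    HasDiscLifting fun γ : C(I, E) => (γ 0, γ 1) := by
  intro n f b hf hb hfb
  let F : (Fin n → ℝ) × ℝ → E := fun p =>
    if p.2 = -1 then (b p.1).1 else if p.2 = 1 then (b p.1).2 else
      f p.1 (projIcc 0 1 zero_le_one ((p.2 + 1) / 2))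
  have mem_iff : ∀ p : (Fin n → ℝ) × ℝ, p ∈ closedBall (0 : (Fin n → ℝ) × ℝ) 1 ↔
      p.1 ∈ closedBall (0 : Fin n → ℝ) 1 ∧ |p.2| ≤ 1 := fun p => by
    simp [Prod.norm_def]
  have hbot : ContinuousOn F (closedBall 0 1 ∩ {p | p.2 = -1}) := by
    refine ContinuousOn.congr (f := fun p => (b p.1).1) ?_ fun p hp => ?_
    swap
    · have h1 : p.2 = -1 := hp.2
      simp only [F, if_pos h1]
    exact continuous_fst.comp_continuousOn
      (hb.comp continuous_fst.continuousOn fun p hp => ((mem_iff p).mp hp.1).1)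
  have htop : ContinuousOn F (closedBall 0 1 ∩ {p | p.2 = 1}) := by
    refine ContinuousOn.congr (f := fun p => (b p.1).2) ?_ fun p hp => ?_
    · exact continuous_snd.comp_continuousOn
        (hb.comp continuous_fst.continuousOn fun p hp => ((mem_iff p).mp hp.1).1)
    · have h1 : p.2 = 1 := hp.2
      have h2 : p.2 ≠ -1 := by rw [h1]; norm_num
      simp only [F, if_neg h2, if_pos h1]
  have hside_eq : ∀ p : (Fin n → ℝ) × ℝ, p.1 ∈ sphere (0 : Fin n → ℝ) 1 →
      F p = f p.1 (projIcc 0 1 zero_le_one ((p.2 + 1) / 2)) := by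
    intro p hp
    have h := hfb p.1 hp
    simp only [F]
    split_ifs with h1 h2
    · rw [← h, h1]
      simp
    · rw [← h, h2]
      norm_num
    · rfl
  have hside : ContinuousOn F (closedBall 0 1 ∩ {p | p.1 ∈ sphere (0 : Fin n → ℝ) 1}) := by
    refine ContinuousOn.congr ?_ fun p hp => hside_eq p hp.2
    have h1 : ContinuousOn (fun p : (Fin n → ℝ) × ℝ => f p.1)
        (closedBall 0 1 ∩ {p | p.1 ∈ sphere (0 : Fin n → ℝ) 1}) :=
      hf.comp continuous_fst.continuousOn fun p hp => hp.2
    have h2 : Continuous fun p : (Fin n → ℝ) × ℝ =>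
        projIcc (0 : ℝ) 1 zero_le_one ((p.2 + 1) / 2) := by fun_prop
    exact (continuous_eval (F := C(I, E))).comp_continuousOn (h1.prodMk h2.continuousOn)
  have hF : ContinuousOn F (sphere 0 1) := by
    have hc1 : IsClosed (closedBall (0 : (Fin n → ℝ) × ℝ) 1 ∩ {p | p.2 = -1}) :=
      isClosed_closedBall.inter (isClosed_eq continuous_snd continuous_const)
    have hc2 : IsClosed (closedBall (0 : (Fin n → ℝ) × ℝ) 1 ∩ {p | p.2 = 1}) :=
      isClosed_closedBall.inter (isClosed_eq continuous_snd continuous_const)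
    have hc3 : IsClosed (closedBall (0 : (Fin n → ℝ) × ℝ) 1 ∩
        {p | p.1 ∈ sphere (0 : Fin n → ℝ) 1}) :=
      isClosed_closedBall.inter (isClosed_sphere.preimage continuous_fst)
    refine (((hbot.union_of_isClosed htop hc1 hc2).union_of_isClosed hside
      (hc1.union hc2) hc3)).mono fun p hp => ?_
    have hp' : p ∈ closedBall (0 : (Fin n → ℝ) × ℝ) 1 := sphere_subset_closedBall hp
    have hmax : max ‖p.1‖ |p.2| = 1 := by simpa [Prod.norm_def] using hp
    rcases max_eq_iff.mp hmax with ⟨h, -⟩ | ⟨h, -⟩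
    · exact Or.inr ⟨hp', by simpa using h⟩
    · rcases eq_or_eq_neg_of_abs_eq h with h | h
      · exact Or.inl (Or.inr ⟨hp', h⟩)
      · exact Or.inl (Or.inl ⟨hp', h⟩)
  obtain ⟨G, hG, hGF⟩ := exists_extension_closedBall hF
  have hmem : ∀ (v : closedBall (0 : Fin n → ℝ) 1) (x : I),
      ((v : Fin n → ℝ), 2 * (x : ℝ) - 1) ∈ closedBall (0 : (Fin n → ℝ) × ℝ) 1 := fun v x =>
    (mem_iff _).mpr ⟨v.2, abs_le.mpr ⟨by linarith [x.2.1], by linarith [x.2.2]⟩⟩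
  -- `2x - 1` undoes the rescaling of path time from `[0, 1]` to `[-1, 1]` in `F`.
  let K : C(closedBall (0 : Fin n → ℝ) 1 × I, E) :=
    ⟨fun p => G ((p.1 : Fin n → ℝ), 2 * (p.2 : ℝ) - 1),
      hG.comp_continuous (by fun_prop) fun p => hmem p.1 p.2⟩
  obtain ⟨g, hg, hgK⟩ := exists_extend_restrict ⟨0, by simp⟩ K.curry
  have hgG : ∀ v ∈ closedBall (0 : Fin n → ℝ) 1, ∀ x : I, g v x = G (v, 2 * (x : ℝ) - 1) :=
    fun v hv x => DFunLike.congr_fun (hgK ⟨v, hv⟩) x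
  have sphere_of : ∀ p : (Fin n → ℝ) × ℝ, p ∈ closedBall (0 : (Fin n → ℝ) × ℝ) 1 →
      (‖p.1‖ = 1 ∨ |p.2| = 1) → p ∈ sphere (0 : (Fin n → ℝ) × ℝ) 1 := by
    intro p hp h
    have hp' := (mem_iff p).mp hp
    rw [mem_closedBall_zero_iff] at hp'
    rw [mem_sphere_zero_iff_norm, Prod.norm_def, Real.norm_eq_abs]
    rcases h with h | h
    · rw [h]; exact max_eq_left hp'.2
    · rw [h]; exact max_eq_right hp'.1
  refine ⟨g, hg, fun v hv => ContinuousMap.ext fun x => ?_, fun v hv => Prod.ext ?_ ?_⟩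
  · have hvc := sphere_subset_closedBall hv
    rw [hgG v hvc, hGF (sphere_of _ (hmem ⟨v, hvc⟩ x) (Or.inl (by simpa using hv))),
      hside_eq _ hv]
    congr 1
    have : ((2 * (x : ℝ) - 1) + 1) / 2 = x := by ring
    simp only [this]
    exact projIcc_val zero_le_one x
  · change g v 0 = _
    rw [hgG v hv, hGF (sphere_of _ (hmem ⟨v, hv⟩ 0) (Or.inr (by simp)))]
    simp [F]
  · change g v 1 = _
    rw [hgG v hv, hGF (sphere_of _ (hmem ⟨v, hv⟩ 1) (Or.inr (by norm_num)))]
    norm_num [F]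

end Discs

/-! ### Lifting over CW pairs -/

section CWLifting

open Metric Set CWComplex

/-- A continuous map from a compact set to a Hausdorff space is closed, hence a quotient map onto
its image. Thus continuity on a closed cell can be tested on the ball. -/
theorem ContinuousOn.of_comp_compact {V X Y : Type*} [TopologicalSpace V] [TopologicalSpace X]
    [T2Space X] [TopologicalSpace Y] {K : Set V} (hK : IsCompact K) {φ : V → X}
    (hφ : ContinuousOn φ K) {F : X → Y} (hF : ContinuousOn (F ∘ φ) K) :
    ContinuousOn F (φ '' K) := by
  rw [continuousOn_iff_isClosed] at hF ⊢
  intro C hC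
  obtain ⟨D, hD, hDK⟩ := hF C hC
  refine ⟨φ '' (D ∩ K), ?_, ?_⟩
  · exact ((hK.inter_left hD).image_of_continuousOn (hφ.mono inter_subset_right)).isClosed
  · rw [← hDK]
    ext x
    constructor
    · rintro ⟨hx, v, hv, rfl⟩
      exact ⟨⟨v, ⟨hx, hv⟩, rfl⟩, v, hv, rfl⟩
    · rintro ⟨⟨v, ⟨hv1, hv2⟩, rfl⟩, h⟩
      exact ⟨hv1, h⟩

theorem continuousOn_biUnion_finset {ι X Y : Type*} [TopologicalSpace X] [TopologicalSpace Y]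
    {f : X → Y} (s : Finset ι) {C : ι → Set X} (hC : ∀ i ∈ s, IsClosed (C i))
    (hf : ∀ i ∈ s, ContinuousOn f (C i)) : ContinuousOn f (⋃ i ∈ s, C i) := by
  classical
  induction s using Finset.induction_on with
  | empty => simp
  | insert a s ha ih =>
    rw [Finset.set_biUnion_insert]
    refine (hf a (by simp)).union_of_isClosed
      (ih (fun i hi => hC i (by simp [hi])) fun i hi => hf i (by simp [hi])) (hC a (by simp)) ?_
    exact s.finite_toSet.isClosed_biUnion fun i hi => hC i (by simp at hi; simp [hi])

variable {X : Type*} [TopologicalSpace X] [T2Space X] [CWComplex (univ : Set X)]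

theorem Topology.CWComplex.continuous_of_continuousOn_closedCell {Y : Type*} [TopologicalSpace Y]
    {f : X → Y} (h : ∀ n (e : cell (univ : Set X) n), ContinuousOn f (closedCell n e)) :
    Continuous f := by
  refine continuous_iff_isClosed.mpr fun C hC => ?_
  rw [CWComplex.closed univ _ (subset_univ _)]
  intro n e
  rw [inter_comm]
  exact (h n e).preimage_isClosed_of_isClosed isClosed_closedCell hC

/-- By closure finiteness the frontier lies in a finite union of closed cells of lower dimension,
where continuity glues. -/
theorem Topology.CWComplex.continuousOn_cellFrontier {Y : Type*} [TopologicalSpace Y]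
    {f : X → Y} {n : ℕ}
    (h : ∀ k < n, ∀ e : cell (univ : Set X) k, ContinuousOn f (closedCell k e))
    (e : cell (univ : Set X) n) : ContinuousOn f (cellFrontier n e) := by
  obtain ⟨J, hJ⟩ := CWComplex.cellFrontier_subset_finite_closedCell n e
  have h1 : ContinuousOn f (⋃ k ∈ Finset.range n, ⋃ j ∈ J k, closedCell k j) := by
    refine continuousOn_biUnion_finset _ (fun k _ => ?_) fun k hk => ?_
    · exact (J k).finite_toSet.isClosed_biUnion fun _ _ => isClosed_closedCell
    · exact continuousOn_biUnion_finset _ (fun _ _ => isClosed_closedCell) fun j _ =>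
        h k (Finset.mem_range.mp hk) j
  refine h1.mono fun x hx => ?_
  simpa using hJ hx

theorem Topology.CWComplex.exists_mem_openCell_of_mem_cellFrontier {n : ℕ}
    {e : cell (univ : Set X) n} {x : X} (hx : x ∈ cellFrontier n e) :
    ∃ k < n, ∃ j : cell (univ : Set X) k, x ∈ openCell k j := by
  obtain ⟨J, hJ⟩ := CWComplex.cellFrontier_subset_finite_openCell n e
  have := hJ hx
  simp only [mem_iUnion, exists_prop] at this
  obtain ⟨k, hk, j, -, hj⟩ := this
  exact ⟨k, hk, j, hj⟩

theorem Topology.CWComplex.exists_mem_openCell_of_mem_closedCell {n : ℕ} {e : cell (univ : Set X) n}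
    {x : X} (hx : x ∈ closedCell n e) :
    ∃ k ≤ n, ∃ j : cell (univ : Set X) k, x ∈ openCell k j := by
  rw [← cellFrontier_union_openCell_eq_closedCell] at hx
  rcases hx with hx | hx
  · obtain ⟨k, hk, j, hj⟩ := exists_mem_openCell_of_mem_cellFrontier hx
    exact ⟨k, hk.le, j, hj⟩
  · exact ⟨n, le_rfl, e, hx⟩

theorem Topology.CWComplex.eq_of_mem_openCell {n k : ℕ} {e : cell (univ : Set X) n}
    {j : cell (univ : Set X) k} {x : X} (he : x ∈ openCell n e) (hj : x ∈ openCell k j) :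
    (⟨n, e⟩ : Σ n, cell (univ : Set X) n) = ⟨k, j⟩ :=
  eq_of_not_disjoint_openCell (not_disjoint_iff.mpr ⟨x, he, hj⟩)

variable {P B : Type*} [TopologicalSpace P] [TopologicalSpace B] {p : P → B}

/-- `f` extends the partial lift `a` on `S` to a lift of `b` on all cells of dimension below
`n`. -/
def IsPartialLift (S : RelCWComplex.Subcomplex (univ : Set X)) (p : P → B) (b : X → B) (a : X → P)
    (n : ℕ) (f : X → P) : Prop :=
  EqOn f a S ∧ ∀ k < n, ∀ e : cell (univ : Set X) k,
    ContinuousOn f (closedCell k e) ∧ ∀ x ∈ closedCell k e, p (f x) = b x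

-- The lower cells determine the lift on the boundary sphere of each `n`-cell, and the disc property
-- fills it in. Only the open `n`-cells outside `S` receive new values; leaving the lower cells
-- untouched makes the construction stabilize.
open Classical in
theorem IsPartialLift.exists_succ (hp : HasDiscLifting p)
    {S : RelCWComplex.Subcomplex (univ : Set X)} {b : X → B} (hb : Continuous b) {a : X → P}
    (ha : ContinuousOn a S) (hab : ∀ x ∈ S, p (a x) = b x) {n : ℕ} {f : X → P}
    (hf : IsPartialLift S p b a n f) :
    ∃ f', IsPartialLift S p b a (n + 1) f' ∧
      ∀ k < n, ∀ e : cell (univ : Set X) k, EqOn f' f (closedCell k e) := by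
  have hext : ∀ e : cell (univ : Set X) n, ∃ g : (Fin n → ℝ) → P,
      ContinuousOn g (closedBall 0 1) ∧ EqOn g (f ∘ map n e) (sphere 0 1) ∧
        ∀ x ∈ closedBall 0 1, p (g x) = b (map n e x) := by
    intro e
    refine hp n (f ∘ map n e) (b ∘ map n e) ?_ ?_ ?_
    · exact (continuousOn_cellFrontier (fun k hk j => (hf.2 k hk j).1) e).comp
        ((continuousOn n e).mono sphere_subset_closedBall) (mapsTo_image _ _)
    · exact hb.comp_continuousOn (continuousOn n e)
    · intro x hx
      obtain ⟨k, hk, j, hj⟩ := exists_mem_openCell_of_mem_cellFrontier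
        (mem_image_of_mem (map n e) hx)
      exact (hf.2 k hk j).2 _ (openCell_subset_closedCell k j hj)
  choose g hg hgf hgb using hext
  let f' : X → P := fun x =>
    if h : ∃ e : cell (univ : Set X) n, e ∉ S.I n ∧ x ∈ openCell n e then
      g h.choose ((map n h.choose).symm x) else f x
  have f'_open : ∀ e : cell (univ : Set X) n, e ∉ S.I n → ∀ x ∈ openCell n e,
      f' x = g e ((map n e).symm x) := by
    intro e he x hx
    have h : ∃ e : cell (univ : Set X) n, e ∉ S.I n ∧ x ∈ openCell n e := ⟨e, he, hx⟩
    have heq : h.choose = e := by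
      have := eq_of_mem_openCell h.choose_spec.2 hx
      simpa using this
    simp only [f', dif_pos h, heq]
  have f'_low : ∀ k < n, ∀ j : cell (univ : Set X) k, ∀ x ∈ openCell k j, f' x = f x := by
    intro k hk j x hx
    refine dif_neg ?_
    rintro ⟨e, -, he⟩
    have := congrArg Sigma.fst (eq_of_mem_openCell he hx)
    exact hk.ne' this
  have f'_S : EqOn f' f S := by
    intro x hx
    refine dif_neg ?_
    rintro ⟨e, he, hxe⟩
    exact disjoint_left.mp
      (RelCWComplex.Subcomplex.disjoint_openCell_subcomplex_of_not_mem S he) hxe hx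
  have f'_closed : ∀ k < n, ∀ e : cell (univ : Set X) k, EqOn f' f (closedCell k e) := by
    intro k hk e x hx
    obtain ⟨l, hl, j, hj⟩ := exists_mem_openCell_of_mem_closedCell hx
    exact f'_low l (hl.trans_lt hk) j x hj
  have f'_map : ∀ e : cell (univ : Set X) n, e ∉ S.I n →
      EqOn (f' ∘ map n e) (g e) (closedBall 0 1) := by
    intro e he x hx
    rw [← sphere_union_ball] at hx
    rcases hx with hx | hx
    · obtain ⟨k, hk, j, hj⟩ := exists_mem_openCell_of_mem_cellFrontier
        (mem_image_of_mem (map n e) hx)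
      exact (f'_low k hk j _ hj).trans (hgf e hx).symm
    · have h := f'_open e he _ (mem_image_of_mem _ hx)
      rwa [(map n e).left_inv (by rwa [source_eq])] at h
  refine ⟨f', ⟨fun x hx => (f'_S hx).trans (hf.1 hx), fun k hk e => ?_⟩, f'_closed⟩
  rcases (Nat.lt_succ_iff.mp hk).lt_or_eq with hk | rfl
  · refine ⟨(hf.2 k hk e).1.congr (f'_closed k hk e), fun x hx => ?_⟩
    rw [f'_closed k hk e hx]
    exact (hf.2 k hk e).2 x hx
  · by_cases he : e ∈ S.I k
    · have hsub := RelCWComplex.Subcomplex.closedCell_subset_of_mem S he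
      have heq : EqOn f' a (closedCell k e) := fun x hx =>
        (f'_S (hsub hx)).trans (hf.1 (hsub hx))
      refine ⟨(ha.mono hsub).congr heq, fun x hx => ?_⟩
      rw [heq hx]
      exact hab x (hsub hx)
    · refine ⟨ContinuousOn.of_comp_compact (isCompact_closedBall _ _) (continuousOn k e)
        ((hg e).congr (f'_map e he)), ?_⟩
      rintro _ ⟨x, hx, rfl⟩
      have := f'_map e he hx
      rw [Function.comp_apply] at this
      rw [this]
      exact hgb e x hx

/-- A map with the lifting property for discs has the lifting property for CW pairs. -/
theorem HasDiscLifting.exists_lift (hp : HasDiscLifting p)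
    (S : RelCWComplex.Subcomplex (univ : Set X)) {b : X → B} (hb : Continuous b) {a : X → P}
    (ha : ContinuousOn a S) (hab : ∀ x ∈ S, p (a x) = b x) :
    ∃ f : X → P, Continuous f ∧ EqOn f a S ∧ ∀ x, p (f x) = b x := by
  choose! next hnext hnext_eq using fun (n : ℕ) (f : X → P) (hf : IsPartialLift S p b a n f) =>
    hf.exists_succ hp hb ha hab
  let F : ℕ → X → P := fun n => Nat.rec a next n
  have hF : ∀ n, IsPartialLift S p b a n (F n) := by
    intro n
    induction n with
    | zero => exact ⟨fun _ _ => rfl, fun k hk => absurd hk (Nat.not_lt_zero k)⟩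
    | succ n ih => exact hnext n _ ih
  have hstab : ∀ n l k, k < n → ∀ e : cell (univ : Set X) k,
      EqOn (F (n + l)) (F n) (closedCell k e) := by
    intro n l k hk e
    induction l with
    | zero => exact fun _ _ => rfl
    | succ l ih => exact fun x hx => (hnext_eq (n + l) _ (hF _) k (by omega) e hx).trans (ih hx)
  have hcover : ∀ x : X, ∃ d, ∃ e : cell (univ : Set X) d, x ∈ closedCell d e := by
    intro x
    have : x ∈ ⋃ (n : ℕ) (j : cell (univ : Set X) n), closedCell n j := by
      rw [CWComplex.union]; trivial
    simpa using this
  choose d e hde using hcover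
  -- At `x` the sequence is constant once it has passed the dimension of a closed cell containing
  -- `x`.
  let f : X → P := fun x => F (d x + 1) x
  have hf : ∀ k (j : cell (univ : Set X) k), EqOn f (F (k + 1)) (closedCell k j) := by
    intro k j x hx
    have h1 := hstab (d x + 1) k (d x) (Nat.lt_succ_self _) (e x) (hde x)
    have h2 := hstab (k + 1) (d x) k (Nat.lt_succ_self _) j hx
    rw [show k + 1 + d x = d x + 1 + k by ring] at h2
    exact h1.symm.trans h2
  refine ⟨f, continuous_of_continuousOn_closedCell fun k j => ?_, fun x hx => ?_, fun x => ?_⟩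
  · exact ((hF (k + 1)).2 k (Nat.lt_succ_self k) j).1.congr (hf k j)
  · exact (hF (d x + 1)).1 hx
  · exact ((hF (d x + 1)).2 (d x) (Nat.lt_succ_self _) (e x)).2 x (hde x)

end CWLifting

/-! ### Polyhedral products of equivalent pairs -/

section Pairs

open Set

/-- A homotopy equivalence of pairs, with homotopies that are constant on the subspaces. -/
def PairEquiv {X Y : Type*} [TopologicalSpace X] [TopologicalSpace Y] (A : Set X) (B : Set Y) :
    Prop :=
  ∃ (f : C(X, Y)) (g : C(Y, X)), MapsTo f A B ∧ MapsTo g B A ∧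
    (g.comp f).HomotopicRel (ContinuousMap.id X) A ∧
    (f.comp g).HomotopicRel (ContinuousMap.id Y) B

variable {ι : Type*} (K : AbstractSimplicialComplex ι)

theorem mapsTo_polyhedralProduct {X Y : ι → Type*} {A : ∀ i, Set (X i)} {B : ∀ i, Set (Y i)}
    {f : ∀ i, X i → Y i} (hf : ∀ i, MapsTo (f i) (A i) (B i)) :
    MapsTo (fun x i => f i (x i)) (polyhedralProduct K A) (polyhedralProduct K B) := by
  intro x hx
  simp only [polyhedralProduct, mem_iUnion] at hx ⊢
  obtain ⟨s, hs, h⟩ := hx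
  exact ⟨s, hs, fun i hi => hf i (h i hi)⟩

/-- The map of polyhedral products induced by maps of pairs. -/
def polyhedralProductMap {X Y : ι → Type*} [∀ i, TopologicalSpace (X i)]
    [∀ i, TopologicalSpace (Y i)] {A : ∀ i, Set (X i)} {B : ∀ i, Set (Y i)} (f : ∀ i, C(X i, Y i))
    (hf : ∀ i, MapsTo (f i) (A i) (B i)) : C(polyhedralProduct K A, polyhedralProduct K B) where
  toFun x := ⟨fun i => f i (x.1 i), mapsTo_polyhedralProduct K hf x.2⟩
  continuous_toFun := Continuous.subtype_mk
    (continuous_pi fun i => (f i).continuous.comp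
      ((continuous_apply i).comp continuous_subtype_val)) _

/-- The homotopies are applied coordinatewise. Being constant on `A i`, they keep `A i` inside
itself at all times, so no point leaves the polyhedral product. -/
theorem polyhedralProductMap_homotopic {X : ι → Type*} [∀ i, TopologicalSpace (X i)]
    {A : ∀ i, Set (X i)} (f : ∀ i, C(X i, X i)) (hf : ∀ i, MapsTo (f i) (A i) (A i))
    (h : ∀ i, (f i).HomotopicRel (ContinuousMap.id (X i)) (A i)) :
    (polyhedralProductMap K f hf).Homotopic (ContinuousMap.id _) := by
  let H := fun i => (h i).some
  refine ⟨⟨⟨fun p => ⟨fun i => H i (p.1, p.2.1 i), ?_⟩, ?_⟩, fun x => ?_, fun x => ?_⟩⟩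
  · refine mapsTo_polyhedralProduct K (f := fun i y => H i (p.1, y)) (fun i y hy => ?_) p.2.2
    change H i (p.1, y) ∈ A i
    rw [(H i).eq_fst p.1 hy]
    exact hf i hy
  · exact Continuous.subtype_mk (continuous_pi fun i => (H i).continuous.comp
      (continuous_fst.prodMk
        ((continuous_apply i).comp (continuous_subtype_val.comp continuous_snd)))) _
  · exact Subtype.ext (funext fun i => (H i).apply_zero _)
  · exact Subtype.ext (funext fun i => (H i).apply_one _)

theorem polyhedralProduct_homotopyEquiv {X Y : ι → Type*} [∀ i, TopologicalSpace (X i)]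
    [∀ i, TopologicalSpace (Y i)] {A : ∀ i, Set (X i)} {B : ∀ i, Set (Y i)}
    (h : ∀ i, PairEquiv (A i) (B i)) :
    Nonempty (ContinuousMap.HomotopyEquiv (polyhedralProduct K A) (polyhedralProduct K B)) := by
  choose f g hf hg hgf hfg using h
  exact ⟨⟨polyhedralProductMap K f hf, polyhedralProductMap K g hg,
    polyhedralProductMap_homotopic K (fun i => (g i).comp (f i)) (fun i => (hg i).comp (hf i)) hgf,
    polyhedralProductMap_homotopic K (fun i => (f i).comp (g i)) (fun i => (hf i).comp (hg i)) hfg⟩⟩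

end Pairs

/-! ### Comparing pairs with an interval and its integer points -/

section Intervals

open Set

variable {X : Type*} [TopologicalSpace X]

/-- Maps to an interval that agree on a set are homotopic relative to this set. -/
theorem homotopicRel_Icc {a b : ℝ} {f g : C(X, Icc a b)} {A : Set X} (h : EqOn f g A) :
    f.HomotopicRel g A := by
  refine ⟨⟨⟨⟨fun p => ⟨(1 - (p.1 : ℝ)) * f p.2 + p.1 * g p.2, ?_⟩, ?_⟩, fun x => ?_, fun x => ?_⟩,
    fun t x hx => ?_⟩⟩
  · exact (convex_Icc a b) (f p.2).2 (g p.2).2 (by linarith [p.1.2.2]) p.1.2.1 (by ring)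
  · fun_prop
  · exact Subtype.ext (by simp)
  · exact Subtype.ext (by simp)
  · refine Subtype.ext ?_
    simp only [ContinuousMap.coe_mk]
    rw [h hx]
    ring

/-- A function on a finite set extends to a continuous map to an interval. -/
theorem exists_extension_Icc [NormalSpace X] [T1Space X] {a b : ℝ} (hab : a ≤ b) {s : Set X}
    (hs : s.Finite) (f : X → Icc a b) : ∃ g : C(X, Icc a b), EqOn g f s := by
  have : Finite s := hs
  -- The finite set is closed and discrete, so Tietze extends any function on it; the result is then
  -- clamped to the interval.
  obtain ⟨g, hg⟩ := ContinuousMap.exists_restrict_eq hs.isClosed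
    (⟨fun x => (f x : ℝ), continuous_of_discreteTopology⟩ : C(s, ℝ))
  refine ⟨⟨fun x => projIcc a b hab (g x), by fun_prop⟩, fun x hx => ?_⟩
  have h : g x = f x := DFunLike.congr_fun hg ⟨x, hx⟩
  change projIcc a b hab (g x) = f x
  rw [h, projIcc_val]

theorem finite_gridPoints (n : ℕ) : (gridPoints n).Finite := by
  refine (Set.finite_range (gridPoint (n := n))).subset fun x hx => ?_
  obtain ⟨k, hk⟩ := exists_gridPoint hx
  exact ⟨k, hk⟩

theorem gridInterval_nonneg (n : ℕ) [NeZero n] : (0 : ℝ) ≤ (n : ℝ) - 1 := by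
  have : (1 : ℝ) ≤ n := by exact_mod_cast Nat.one_le_iff_ne_zero.mpr (NeZero.ne n)
  linarith

/-- A path through given points of a path connected space, on the interval `[0, n - 1]`. -/
theorem exists_map_gridPoint [PathConnectedSpace X] (n : ℕ) [NeZero n] (y : Fin n → X) :
    ∃ g : C(Icc (0 : ℝ) ((n : ℝ) - 1), X), ∀ k, g (gridPoint k) = y k := by
  obtain ⟨n, rfl⟩ := Nat.exists_eq_succ_of_ne_zero (NeZero.ne n)
  obtain ⟨γ, t, ht⟩ := PathConnectedSpace.exists_path_through_family' y
  obtain ⟨c, hc⟩ := exists_extension_Icc (zero_le_one' ℝ) (finite_gridPoints (n + 1))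
    (Function.extend gridPoint t fun _ => 0)
  refine ⟨(γ : C(I, X)).comp c, fun k => ?_⟩
  change γ (c (gridPoint k)) = y k
  rw [hc (gridPoint_mem k), gridPoint_injective.extend_apply, ht]

/-- Path connectedness gives the map from the interval, and convexity the homotopy on it. What
depends on `X` is the map `f` and the deformation of self-maps fixing `A`. -/
theorem pairEquiv_gridPoints [PathConnectedSpace X] {A : Set X} {n : ℕ} [NeZero n]
    (ε : Fin n ≃ A) (f : C(X, Icc (0 : ℝ) ((n : ℝ) - 1))) (hf : ∀ k, f (ε k) = gridPoint k)
    (hrel : ∀ g : C(X, X), EqOn g id A → g.HomotopicRel (ContinuousMap.id X) A) :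
    PairEquiv A (gridPoints n) := by
  obtain ⟨g, hg⟩ := exists_map_gridPoint n fun k => (ε k : X)
  have hfA : ∀ x ∈ A, ∃ k, (ε k : X) = x := fun x hx => ⟨ε.symm ⟨x, hx⟩, by simp⟩
  refine ⟨f, g, ?_, ?_, hrel _ ?_, homotopicRel_Icc ?_⟩
  · intro x hx
    obtain ⟨k, rfl⟩ := hfA x hx
    rw [hf]
    exact gridPoint_mem k
  · intro x hx
    obtain ⟨k, rfl⟩ := exists_gridPoint hx
    rw [hg]
    exact (ε k).2
  · intro x hx
    obtain ⟨k, rfl⟩ := hfA x hx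
    simp [hf, hg]
  · intro x hx
    obtain ⟨k, rfl⟩ := exists_gridPoint hx
    simp [hf, hg]

theorem pairEquiv_unitInterval {n : ℕ} [NeZero n] (F : Finset I) (hF : F.card = n) :
    PairEquiv (F : Set I) (gridPoints n) := by
  let ε : Fin n ≃ (F : Set I) := (F.equivFinOfCardEq hF).symm
  obtain ⟨f, hf⟩ := exists_extension_Icc (gridInterval_nonneg n) F.finite_toSet
    (Function.extend (fun k => (ε k : I)) gridPoint fun _ => gridPoint 0)
  have : PathConnectedSpace I :=
    isPathConnected_iff_pathConnectedSpace.mp ((convex_Icc 0 1).isPathConnected ⟨0, by simp⟩)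
  refine pairEquiv_gridPoints ε f (fun k => ?_) fun g hg => homotopicRel_Icc hg
  rw [hf (ε k).2]
  exact (Subtype.val_injective.comp ε.injective).extend_apply _ _ k

end Intervals

/-! ### Universal pairs -/

section Universal

open Set

/-- Both missing ingredients are lifts over the CW pair: `f` extends a map from a finite set to a
contractible interval, and a homotopy from `g` to the identity lifts `(g, id)` through the endpoint
map of the path space, starting from constant paths on `A`. -/
theorem pairEquiv_of_isCWPair {X : Type*} [TopologicalSpace X] [ContractibleSpace X] {A : Set X}
    (hA : IsCWPair A) {n : ℕ} [NeZero n] (ε : Fin n ≃ A) : PairEquiv A (gridPoints n) := by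
  obtain ⟨hT2, hCW, S, rfl⟩ := hA
  have hfin : (S : Set X).Finite := Finite.of_equiv _ ε
  have : ContractibleSpace (Icc (0 : ℝ) ((n : ℝ) - 1)) :=
    (convex_Icc _ _).contractibleSpace ⟨0, by simpa using gridInterval_nonneg n⟩
  obtain ⟨f, hf, hfa, -⟩ := (hasDiscLifting_const (Icc (0 : ℝ) ((n : ℝ) - 1))).exists_lift S
    (b := fun _ => ()) continuous_const
    (a := Function.extend (fun k => (ε k : X)) gridPoint fun _ => gridPoint 0)
    (hfin.continuousOn _) fun _ _ => rfl
  refine pairEquiv_gridPoints ε ⟨f, hf⟩ (fun k => ?_) fun g hg => ?_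
  · change f (ε k) = _
    rw [hfa (ε k).2]
    exact (Subtype.val_injective.comp ε.injective).extend_apply _ _ k
  · obtain ⟨h, hh, hha, hhb⟩ := (hasDiscLifting_endpoints X).exists_lift S
      (b := fun x => (g x, x)) (by fun_prop) (a := fun x => ContinuousMap.const I x)
      (hfin.continuousOn _) fun x hx => by simp [hg hx]
    refine ⟨⟨⟨(ContinuousMap.uncurry ⟨h, hh⟩).comp ⟨Prod.swap, continuous_swap⟩,
      fun x => congrArg Prod.fst (hhb x), fun x => congrArg Prod.snd (hhb x)⟩, fun t x hx => ?_⟩⟩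
    change h x t = g x
    rw [hha hx, hg hx]
    rfl

theorem IsUniversalPair.pairEquiv {G E : Type*} [Group G] [Finite G] [TopologicalSpace E]
    [MulAction G E] {x : E} (h : IsUniversalPair G E x) {n : ℕ} [NeZero n] (hn : Nat.card G = n) :
    PairEquiv (MulAction.orbit G x) (gridPoints n) := by
  have := h.contractible
  have hinj : Function.Injective fun g : G => g • x := fun g g' hgg => by
    have h1 : (g'⁻¹ * g) • x = x := by
      rw [mul_smul, inv_smul_eq_iff]
      exact hgg
    exact (inv_mul_eq_one.mp (h.free _ _ h1)).symm
  exact pairEquiv_of_isCWPair h.isCWPair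
    ((Finite.equivFinOfCardEq hn).symm.trans (Equiv.ofInjective _ hinj))

end Universal

theorem mainTheorem8 (r : ℕ) (G : Fin r → Type*) [∀ i, Group (G i)] [∀ i, Finite (G i)]
    (m : Fin r → ℕ) (hm : ∀ i, Nat.card (G i) = m i) :
    -- `Z_K(I, F)` is a wedge of `N_r` circles
    (∀ F : Fin r → Finset unitInterval, (∀ i, (F i).card = m i) →
      Nonempty (ContinuousMap.HomotopyEquiv
        (polyhedralProduct (discreteComplex r) fun i => (F i : Set unitInterval))
        (WedgeOfCircles (circleCount r m)))) ∧
    -- `Z_K(EG, G)` is a wedge of `N_r` circles, and homotopy equivalent to `Z_K(I, F)`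
    (∀ (E : Fin r → Type*) [∀ i, TopologicalSpace (E i)] [∀ i, MulAction (G i) (E i)]
      (x : ∀ i, E i), (∀ i, IsUniversalPair (G i) (E i) (x i)) →
      Nonempty (ContinuousMap.HomotopyEquiv
        (polyhedralProduct (discreteComplex r) fun i => MulAction.orbit (G i) (x i))
        (WedgeOfCircles (circleCount r m))) ∧
      ∀ F : Fin r → Finset unitInterval, (∀ i, (F i).card = m i) →
        Nonempty (ContinuousMap.HomotopyEquiv
          (polyhedralProduct (discreteComplex r) fun i => MulAction.orbit (G i) (x i))
          (polyhedralProduct (discreteComplex r) fun i => (F i : Set unitInterval)))) ∧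
    -- the closed form of `N_r`
    ((circleCount r m : ℤ) =
      ((r : ℤ) - 1) * ∏ i, (m i : ℤ) - ∑ i, ∏ j ∈ Finset.univ.erase i, (m j : ℤ) + 1) ∧
    -- the kernel of the free product onto the product is free of rank `N_r`
    (Function.Surjective (freeProductToProduct G) ∧
      Nonempty ((freeProductToProduct G).ker ≃* FreeGroup (Fin (circleCount r m)))) := by
  have hpos : ∀ i, 0 < m i := fun i => hm i ▸ Nat.card_pos
  have : ∀ i, NeZero (m i) := fun i => ⟨(hpos i).ne'⟩
  -- All polyhedral products below are compared with this one grid.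
  obtain ⟨w⟩ := gridSpace_homotopyEquiv_wedge m
  have hI : ∀ F : Fin r → Finset unitInterval, (∀ i, (F i).card = m i) →
      Nonempty (ContinuousMap.HomotopyEquiv
        (polyhedralProduct (discreteComplex r) fun i => (F i : Set unitInterval))
        (GridSpace m)) := fun F hF =>
    polyhedralProduct_homotopyEquiv _ fun i => pairEquiv_unitInterval (F i) (hF i)
  refine ⟨fun F hF => ?_, fun E _ _ x hx => ?_, circleCount_closed_form r m hpos,
    freeProductToProduct_surjective G, ?_⟩
  · obtain ⟨e⟩ := hI F hF
    exact ⟨e.trans w⟩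
  · obtain ⟨e⟩ := polyhedralProduct_homotopyEquiv (discreteComplex r)
      fun i => (hx i).pairEquiv (hm i)
    refine ⟨⟨e.trans w⟩, fun F hF => ?_⟩
    obtain ⟨e'⟩ := hI F hF
    exact ⟨e.trans e'.symm⟩
  · obtain rfl : (fun i => Nat.card (G i)) = m := funext hm
    exact freeProductToProduct_ker_free G
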